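/- Let $N\in\mathbb Z$. Complexes are cochain complexes of $\mathbb C$-vector spaces. **dg Lie algebras.** A dg Lie algebra with bracket of degree $q$ is a complex $(\mathfrak g^{[*]},d)$ with a bilinear bracket such that, for homogeneous $a,b,c$: $|[a,b]|=|a|+|b|+q$; $d[a,b]=[da,b]+(-1)^{|a|+q}[a,db]$; $[a,b]=-(-1)^{(|a|+q)(|b|+q)}[b,a]$; $[a,[b,c]]=[[a,b],c]+(-1)^{(|a|+q)(|b|+q)}[b,[a,c]]$. **dg vertex Lie algebras.** A dg vertex Lie algebra (with $|x|=-2N$) is a complex $(U^{[*]},d)$ with a linear map $u\mapsto Y^-(u,x)=\sum_{n\ge 0}u_{(n)}x^{-n-1}$, $u_{(n)}\in\mathrm{End}(U)$, such that for homogeneous $u,v$ one has $|u_{(n)}v|=|u|+|v|-2N(n+1)$ and $d(u_{(n)}v)=(du)_{(n)}v+(-1)^{|u|}u_{(n)}dv$, and with a linear map $\mathcal D:U\to U$ of degree $2N$ commuting with $d$, such that for homogeneous $u,v$: (i) $u_{(n)}v=0$ for $n\gg0$; (ii) $[\mathcal D,Y^-(u,x)]=Y^-(\mathcal Du,x)=\frac{d}{dx}Y^-(u,x)$;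 (iii) $Y^-(u,x)v\simeq(-1)^{|u||v|}e^{x\mathcal D}Y^-(v,-x)u$; (iv) $x_2^{-1}\delta(\frac{x_1-x_0}{x_2})Y^-(Y^-(u,x_0)v,x_2)\simeq x_0^{-1}\delta(\frac{x_1-x_2}{x_0})Y^-(u,x_1)Y^-(v,x_2)-(-1)^{|u||v|}x_0^{-1}\delta(\frac{x_2-x_1}{-x_0})Y^-(v,x_2)Y^-(u,x_1)$. Here $\delta(\frac{x-y}{z})=\sum_{n\in\mathbb Z}\sum_{m\ge0}(-1)^m\binom nm x^{n-m}y^mz^{-n}$, and $\simeq$ means equality of the coefficients of all monomials in which every variable has a strictly negative exponent. **The dg Lie algebra of a dg vertex Lie algebra.** Give $\mathbb C[t,t^{-1}]$ the grading $|t|=-2N$ and zero differential. For a dg vertex Lie algebra $U^{[*]}$ let $\mathcal L(U^{[*]})$ be the quotient complex of $U^{[*]}\otimes\mathbb C[t,t^{-1}]$ by the image of $u\otimes t^n\mapsto\mathcal Du\otimes t^n+n\,u\otimes t^{n-1}$. Write $u_n$ for the class of $u\otimes t^n$, so that $d(u_n)=(du)_n$, and equip $\mathcal L(U^{[*]})$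 with the (well-defined) bracket $[u_n,v_p]=\sum_{i\ge0}\binom ni(u_{(i)}v)_{n+p-i}$. **The data.** Let $(\mathfrak g^{[*]},d)$ be a dg Lie algebra with bracket of degree $-2N$, and let $\langle\cdot,\cdot\rangle:\mathfrak g\times\mathfrak g\to\mathbb C$ be a bilinear form such that, for homogeneous $a,b,c$: $\langle a,b\rangle=0$ unless $|a|+|b|=4N$; $\langle da,b\rangle+(-1)^{|a|}\langle a,db\rangle=0$; $\langle a,b\rangle=(-1)^{|a|}\langle b,a\rangle$; $\langle[a,b],c\rangle=\langle a,[b,c]\rangle$. Let $\widehat{\mathfrak g}^{[*]}=\mathfrak g^{[*]}\otimes\mathbb C[t,t^{-1}]\oplus\mathbb CK$ with $|t|=-2N$, $|K|=2N$, $d(a\otimes t^n)=da\otimes t^n$, $dK=0$, with $K$ central and $$[a\otimes t^m,b\otimes t^n]=[a,b]\otimes t^{m+n}+m\langle a,b\rangle\delta_{m+n,0}K .$$ Let $U^{[*]}=\mathbb C[\mathcal D]\otimes\mathfrak g^{[*]}\oplus\mathbb C\mathbf K$ with $|\mathcal D|=2N$, $|\mathbf K|=0$, $d(\mathcal D^ka)=\mathcal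 D^k(da)$, $d\mathbf K=0$, $\mathcal D\mathbf K=0$. With $\mathcal D^{(k)}=\frac1{k!}\mathcal D^k$, the products $u_{(n)}v$ ($n\ge0$) are the bilinear ones determined, for $a,b\in\mathfrak g$ and $k\ge0$, by - $a_{(0)}b=[a,b]$, $a_{(1)}b=\langle a,b\rangle\mathbf K$, $a_{(n)}b=0$ for $n\ge2$; - $a_{(n)}\mathbf K=0$ and $\mathbf K_{(n)}=0$; - $a_{(n)}(\mathcal D^{(k)}b)=\sum_{i=0}^k\binom ni\mathcal D^{(k-i)}(a_{(n-i)}b)$; - $((-\mathcal D)^{(k)}a)_{(n)}=\binom nk a_{(n-k)}$. **Proposition.** $U^{[*]}$ is a dg vertex Lie algebra; $\mathcal L(U^{[*]})$ and $\widehat{\mathfrak g}^{[*]}$ are dg Lie algebras with brackets of degree $-2N$; and there is an isomorphism of dg Lie algebras $\mathcal L(U^{[*]})\to\widehat{\mathfrak g}^{[*]}$ (linear bijection preserving degrees, differentials and brackets) with $a_n\mapsto a\otimes t^n$ for all $a\in\mathfrak g$, $n\in\mathbb Z$, and $\mathbf K_{-1}\mapsto K$. -/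

import Mathlib

noncomputable section

namespace DGVertex

/-! ### Cochain complexes and dg Lie algebras

A cochain complex over `ℂ` is given by its total space `V = ⨁ₚ V^[p]`, the family of
homogeneous pieces `𝒱 p = V^[p]` and the differential `d`. -/

section Complexes

variable {V : Type*} [AddCommGroup V] [Module ℂ V]

/-- `(V, d)` with homogeneous pieces `𝒱 p` is a cochain complex over `ℂ`. -/
structure IsCochainComplex (𝒱 : ℤ → Submodule ℂ V) (d : V →ₗ[ℂ] V) : Prop where
  isInternal : DirectSum.IsInternal 𝒱
  d_mem : ∀ (p : ℤ) (v : V), v ∈ 𝒱 p → d v ∈ 𝒱 (p + 1)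
  d_d : ∀ v : V, d (d v) = 0

/-- A dg Lie algebra whose bracket has degree `q`. -/
structure IsDGLieAlgebra (q : ℤ) (𝒱 : ℤ → Submodule ℂ V) (d : V →ₗ[ℂ] V)
    (br : V →ₗ[ℂ] V →ₗ[ℂ] V) : Prop extends IsCochainComplex 𝒱 d where
  br_mem : ∀ (m n : ℤ) (a b : V), a ∈ 𝒱 m → b ∈ 𝒱 n → br a b ∈ 𝒱 (m + n + q)
  d_br : ∀ (m : ℤ) (a b : V), a ∈ 𝒱 m →
    d (br a b) = br (d a) b + (-1 : ℂ) ^ (m + q) • br a (d b)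
  antisymm : ∀ (m n : ℤ) (a b : V), a ∈ 𝒱 m → b ∈ 𝒱 n →
    br a b = -((-1 : ℂ) ^ ((m + q) * (n + q)) • br b a)
  jacobi : ∀ (m n : ℤ) (a b c : V), a ∈ 𝒱 m → b ∈ 𝒱 n →
    br a (br b c) = br (br a b) c + (-1 : ℂ) ^ ((m + q) * (n + q)) • br b (br a c)

/-- An invariant form `⟨·,·⟩ : V ⊗ V → ℂ[2q]` on a dg Lie algebra with bracket of degree `q`. -/
structure IsInvariantForm (q : ℤ) (𝒱 : ℤ → Submodule ℂ V) (d : V →ₗ[ℂ] V)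
    (br : V →ₗ[ℂ] V →ₗ[ℂ] V) (form : V →ₗ[ℂ] V →ₗ[ℂ] ℂ) : Prop where
  degree : ∀ (m n : ℤ) (a b : V), a ∈ 𝒱 m → b ∈ 𝒱 n → m + n + 2 * q ≠ 0 → form a b = 0
  d_form : ∀ (m : ℤ) (a b : V), a ∈ 𝒱 m →
    form (d a) b + (-1 : ℂ) ^ (m + 2 * q) * form a (d b) = 0
  symm : ∀ (m n : ℤ) (a b : V), a ∈ 𝒱 m → b ∈ 𝒱 n →
    form a b = (-1 : ℂ) ^ (m + 2 * q) * form b a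
  invariant : ∀ a b c : V, form (br a b) c = form a (br b c)

/-- The linear bijection `φ` is an isomorphism of dg Lie algebras. -/
structure IsDGLieIso {W : Type*} [AddCommGroup W] [Module ℂ W]
    (𝒱 : ℤ → Submodule ℂ V) (dV : V →ₗ[ℂ] V) (brV : V →ₗ[ℂ] V →ₗ[ℂ] V)
    (𝒲 : ℤ → Submodule ℂ W) (dW : W →ₗ[ℂ] W) (brW : W →ₗ[ℂ] W →ₗ[ℂ] W)
    (φ : V ≃ₗ[ℂ] W) : Prop where
  mem_iff : ∀ (p : ℤ) (v : V), φ v ∈ 𝒲 p ↔ v ∈ 𝒱 p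
  map_d : ∀ v : V, φ (dV v) = dW (φ v)
  map_br : ∀ v w : V, φ (brV v w) = brW (φ v) (φ w)

end Complexes

/-! ### dg vertex Lie algebras -/

section VertexLie

variable {U : Type*} [AddCommGroup U] [Module ℂ U]

/-- The coefficient of `x ^ e` in `Y⁻(u, x) v = ∑_{n ≥ 0} u_(n) v x ^ (-n-1)`, where
`mode n u v = u_(n) v`. -/
def Yminus (mode : ℕ → U →ₗ[ℂ] U →ₗ[ℂ] U) (u v : U) (e : ℤ) : U :=
  if e < 0 then mode (-e - 1).toNat u v else 0

/-- The coefficient of `x₀ ^ e₀ x₁ ^ e₁ x₂ ^ e₂` in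
`x₂⁻¹ δ((x₁ - x₀) / x₂) Y⁻(Y⁻(u, x₀) v, x₂) w`, where
`x₂⁻¹ δ((x₁ - x₀) / x₂) = ∑_{n ∈ ℤ} ∑_{m ≥ 0} (-1)^m (n choose m) x₁^(n-m) x₀^m x₂^(-n-1)`
(only the terms with `n - m = e₁` contribute). -/
def jacobiIterate (mode : ℕ → U →ₗ[ℂ] U →ₗ[ℂ] U) (u v w : U) (e₀ e₁ e₂ : ℤ) : U :=
  ∑ᶠ m : ℕ, ((-1 : ℤ) ^ m * Ring.choose (e₁ + m) m) •
    Yminus mode (Yminus mode u v (e₀ - m)) w (e₂ + (e₁ + m) + 1)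

/-- The coefficient of `x₀ ^ e₀ x₁ ^ e₁ x₂ ^ e₂` in
`x₀⁻¹ δ((x₁ - x₂) / x₀) Y⁻(u, x₁) Y⁻(v, x₂) w`, where
`x₀⁻¹ δ((x₁ - x₂) / x₀) = ∑_{n ∈ ℤ} ∑_{m ≥ 0} (-1)^m (n choose m) x₁^(n-m) x₂^m x₀^(-n-1)`
(only the terms with `n = -e₀ - 1` contribute). -/
def jacobiProduct (mode : ℕ → U →ₗ[ℂ] U →ₗ[ℂ] U) (u v w : U) (e₀ e₁ e₂ : ℤ) : U :=
  ∑ᶠ m : ℕ, ((-1 : ℤ) ^ m * Ring.choose (-e₀ - 1) m) •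
    Yminus mode u (Yminus mode v w (e₂ - m)) (e₁ - (-e₀ - 1) + m)

/-- The coefficient of `x₀ ^ e₀ x₁ ^ e₁ x₂ ^ e₂` in
`x₀⁻¹ δ((x₂ - x₁) / (-x₀)) Y⁻(v, x₂) Y⁻(u, x₁) w`, where `x₀⁻¹ δ((x₂ - x₁) / (-x₀)) =
∑_{n ∈ ℤ} (-1)^n ∑_{m ≥ 0} (-1)^m (n choose m) x₂^(n-m) x₁^m x₀^(-n-1)`
(only the terms with `n = -e₀ - 1` contribute). -/
def jacobiOpposite (mode : ℕ → U →ₗ[ℂ] U →ₗ[ℂ] U) (u v w : U) (e₀ e₁ e₂ : ℤ) : U :=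
  ((-1 : ℂ) ^ (-e₀ - 1)) • ∑ᶠ m : ℕ, ((-1 : ℤ) ^ m * Ring.choose (-e₀ - 1) m) •
    Yminus mode v (Yminus mode u w (e₁ - m)) (e₂ - (-e₀ - 1) + m)

/-- A dg vertex Lie algebra with formal variable `x` of degree `-2N`: the complex `(U, d)`,
the modes `mode n u v = u_(n) v` of `Y⁻(u, x) v`, and the operator `D` of degree `2N`.
As `D` has even degree, the super commutator with `D` is the ordinary commutator. The relation
`≃` of equality of singular parts is equality of the coefficients of the monomials in which every
variable has a strictly negative exponent. -/
structure IsDGVertexLieAlgebra (N : ℤ) (𝒰 : ℤ → Submodule ℂ U) (d : U →ₗ[ℂ] U)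
    (mode : ℕ → U →ₗ[ℂ] U →ₗ[ℂ] U) (D : U →ₗ[ℂ] U) : Prop extends IsCochainComplex 𝒰 d where
  /-- `Y⁻` is homogeneous of degree `0`. -/
  mode_mem : ∀ (n : ℕ) (p q : ℤ) (u v : U), u ∈ 𝒰 p → v ∈ 𝒰 q →
    mode n u v ∈ 𝒰 (p + q - 2 * N * (n + 1))
  /-- `Y⁻` commutes with the differentials. -/
  d_mode : ∀ (n : ℕ) (p : ℤ) (u v : U), u ∈ 𝒰 p →
    d (mode n u v) = mode n (d u) v + (-1 : ℂ) ^ (p - 2 * N * (n + 1)) • mode n u (d v)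
  /-- `D : U → U[2N]` is a chain map. -/
  D_mem : ∀ (p : ℤ) (u : U), u ∈ 𝒰 p → D u ∈ 𝒰 (p + 2 * N)
  D_d : ∀ u : U, D (d u) = d (D u)
  truncation : ∀ u v : U, ∃ n₀ : ℕ, ∀ n : ℕ, n₀ ≤ n → mode n u v = 0
  /-- `[D, Y⁻(u, x)] = Y⁻(D u, x)`. -/
  D_comm : ∀ (u v : U) (e : ℤ),
    D (Yminus mode u v e) - Yminus mode u (D v) e = Yminus mode (D u) v e
  /-- `Y⁻(D u, x) = d/dx Y⁻(u, x)`. -/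
  D_deriv : ∀ (u v : U) (e : ℤ),
    Yminus mode (D u) v e = (e + 1) • Yminus mode u v (e + 1)
  /-- `Y⁻(u, x) v ≃ (-1)^(|u||v|) e^(xD) Y⁻(v, -x) u`. -/
  half_skew : ∀ (p q : ℤ) (u v : U), u ∈ 𝒰 p → v ∈ 𝒰 q → ∀ e : ℤ, e < 0 →
    Yminus mode u v e = (-1 : ℂ) ^ (p * q) • ∑ᶠ k : ℕ, ((k.factorial : ℂ)⁻¹) •
      (D ^ k) ((-1 : ℂ) ^ (e - k) • Yminus mode v u (e - k))
  half_jacobi : ∀ (p q : ℤ) (u v w : U), u ∈ 𝒰 p → v ∈ 𝒰 q →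
    ∀ e₀ e₁ e₂ : ℤ, e₀ < 0 → e₁ < 0 → e₂ < 0 →
    jacobiIterate mode u v w e₀ e₁ e₂ = jacobiProduct mode u v w e₀ e₁ e₂ -
      (-1 : ℂ) ^ (p * q) • jacobiOpposite mode u v w e₀ e₁ e₂

end VertexLie

/-! ### Bilinear maps on finitely supported families

For a vector space `M`, the space `ℤ →₀ M` is `M ⊗ ℂ[t, t⁻¹]`, with `Finsupp.single n a` standing
for `a ⊗ t ^ n`; likewise `ℕ →₀ M` is `ℂ[D] ⊗ M`, with `Finsupp.single k a` standing for
`D ^ k ⊗ a`. -/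

section Bilinear

variable {ι κ M M' P : Type*} [AddCommGroup M] [Module ℂ M] [AddCommGroup M'] [Module ℂ M']
  [AddCommGroup P] [Module ℂ P]

/-- The bilinear map with value `B i j a b` on `(single i a, single j b)`. -/
def finsuppBilin (B : ι → κ → M →ₗ[ℂ] M' →ₗ[ℂ] P) :
    (ι →₀ M) →ₗ[ℂ] (κ →₀ M') →ₗ[ℂ] P :=
  Finsupp.lsum ℂ fun i => (Finsupp.lsum ℂ fun j => (B i j).flip).flip

@[simp]
theorem finsuppBilin_single (B : ι → κ → M →ₗ[ℂ] M' →ₗ[ℂ] P) (i : ι) (j : κ) (a : M) (b : M') :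
    finsuppBilin B (Finsupp.single i a) (Finsupp.single j b) = B i j a b := by
  simp [finsuppBilin]

end Bilinear

/-! ### The loop complex `M ⊗ ℂ[t, t⁻¹]`, with `|t| = -2N` -/

section Loop

variable {M : Type*} [AddCommGroup M] [Module ℂ M]

/-- The degree `p` part of `M ⊗ ℂ[t, t⁻¹]`: since `|a ⊗ t ^ n| = |a| - 2Nn`, the coefficient of
`t ^ n` has to lie in `M^[p + 2Nn]`. -/
def loopDeg (N : ℤ) (𝒱 : ℤ → Submodule ℂ M) (p : ℤ) : Submodule ℂ (ℤ →₀ M) where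
  carrier := {f | ∀ n : ℤ, f n ∈ 𝒱 (p + 2 * N * n)}
  add_mem' hf hg n := (𝒱 _).add_mem (hf n) (hg n)
  zero_mem' _ := (𝒱 _).zero_mem
  smul_mem' c _ hf n := (𝒱 _).smul_mem c (hf n)

/-- `d (a ⊗ t ^ n) = d a ⊗ t ^ n`. -/
def loopD (d : M →ₗ[ℂ] M) : (ℤ →₀ M) →ₗ[ℂ] (ℤ →₀ M) :=
  Finsupp.mapRange.linearMap d

end Loop

/-! ### The dg Lie algebra `𝓛(U)` of a dg vertex Lie algebra `U` -/

section ModeLie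

variable {U : Type*} [AddCommGroup U] [Module ℂ U]

/-- `D̂ (u ⊗ t ^ n) = D u ⊗ t ^ n + n u ⊗ t ^ (n - 1)`. -/
def Dhat (D : U →ₗ[ℂ] U) : (ℤ →₀ U) →ₗ[ℂ] (ℤ →₀ U) :=
  Finsupp.lsum ℂ fun n : ℤ =>
    (Finsupp.lsingle n).comp D + (n : ℂ) • Finsupp.lsingle (n - 1)

@[simp]
theorem Dhat_single (D : U →ₗ[ℂ] U) (n : ℤ) (u : U) :
    Dhat D (Finsupp.single n u) =
      Finsupp.single n (D u) + (n : ℂ) • Finsupp.single (n - 1) u := by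
  simp [Dhat]

/-- The space `𝓛(U) = U ⊗ ℂ[t, t⁻¹] / D̂ (U ⊗ ℂ[t, t⁻¹])`. -/
abbrev ModeLie (D : U →ₗ[ℂ] U) : Type _ :=
  (ℤ →₀ U) ⧸ LinearMap.range (Dhat D)

/-- The element `u_n` of `𝓛(U)`, the class of `u ⊗ t ^ n`. -/
def modeOf (D : U →ₗ[ℂ] U) (n : ℤ) : U →ₗ[ℂ] ModeLie D :=
  (LinearMap.range (Dhat D)).mkQ.comp (Finsupp.lsingle n)

/-- The degree `p` part of `𝓛(U)`: the image of the degree `p` part of `U ⊗ ℂ[t, t⁻¹]`. -/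
def modeLieDeg (N : ℤ) (𝒰 : ℤ → Submodule ℂ U) (D : U →ₗ[ℂ] U) (p : ℤ) :
    Submodule ℂ (ModeLie D) :=
  (loopDeg N 𝒰 p).map (LinearMap.range (Dhat D)).mkQ

namespace IsDGVertexLieAlgebra

variable {N : ℤ} {𝒰 : ℤ → Submodule ℂ U} {d : U →ₗ[ℂ] U}
  {mode : ℕ → U →ₗ[ℂ] U →ₗ[ℂ] U} {D : U →ₗ[ℂ] U}

theorem loopD_Dhat (h : IsDGVertexLieAlgebra N 𝒰 d mode D) (f : ℤ →₀ U) :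
    loopD d (Dhat D f) = Dhat D (loopD d f) := by
  induction f using Finsupp.induction_linear with
  | zero => simp
  | add f g hf hg => simp [hf, hg]
  | single n u =>
    rw [Dhat_single, map_add, map_smul]
    simp [loopD, h.D_d]

/-- The differential of `𝓛(U)`: `d (u_n) = (d u)_n`. -/
def modeLieD (h : IsDGVertexLieAlgebra N 𝒰 d mode D) : ModeLie D →ₗ[ℂ] ModeLie D :=
  Submodule.mapQ _ _ (loopD d) <| by
    rintro _ ⟨f, rfl⟩
    exact ⟨loopD d f, (h.loopD_Dhat f).symm⟩

theorem finite_support (h : IsDGVertexLieAlgebra N 𝒰 d mode D) (u v : U) (c : ℕ → ℤ)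
    (e : ℕ → ℤ) :
    (Function.support fun i : ℕ => c i • Finsupp.single (e i) (mode i u v)).Finite := by
  obtain ⟨n₀, hn⟩ := h.truncation u v
  refine (Set.finite_lt_nat n₀).subset fun i hi => ?_
  by_contra hlt
  exact hi (by simp [hn i (not_lt.1 hlt)])

/-- The bilinear map `(u, v) ↦ ∑_{i ≥ 0} (n choose i) u_(i) v ⊗ t ^ (n + p - i)`. -/
def loopTerm (h : IsDGVertexLieAlgebra N 𝒰 d mode D) (n p : ℤ) :
    U →ₗ[ℂ] U →ₗ[ℂ] (ℤ →₀ U) :=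
  LinearMap.mk₂ ℂ
    (fun u v => ∑ᶠ i : ℕ, Ring.choose n i • Finsupp.single (n + p - i) (mode i u v))
    (fun u u' v => by
      rw [← finsum_add_distrib (h.finite_support ..) (h.finite_support ..)]
      simp)
    (fun c u v => by
      rw [smul_finsum' c (h.finite_support ..)]
      simp only [map_smul, LinearMap.smul_apply, ← Finsupp.smul_single]
      exact finsum_congr fun i => smul_comm ..)
    (fun u v v' => by
      rw [← finsum_add_distrib (h.finite_support ..) (h.finite_support ..)]
      simp)
    (fun c u v => by
      rw [smul_finsum' c (h.finite_support ..)]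
      simp only [map_smul, ← Finsupp.smul_single]
      exact finsum_congr fun i => smul_comm ..)

/-- The bilinear map `{u ⊗ t ^ n, v ⊗ t ^ p} = ∑_{i ≥ 0} (n choose i) u_(i) v ⊗ t ^ (n + p - i)`
on `U ⊗ ℂ[t, t⁻¹]`. -/
def loopBracket (h : IsDGVertexLieAlgebra N 𝒰 d mode D) :
    (ℤ →₀ U) →ₗ[ℂ] (ℤ →₀ U) →ₗ[ℂ] (ℤ →₀ U) :=
  finsuppBilin h.loopTerm

theorem exists_loopTerm_eq_sum (h : IsDGVertexLieAlgebra N 𝒰 d mode D) (u v : U) :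
    ∃ n₀ : ℕ, (∀ n, n₀ ≤ n → mode n u v = 0) ∧ ∀ (k : ℕ), n₀ ≤ k → ∀ n p : ℤ,
      h.loopTerm n p u v =
        ∑ i ∈ Finset.range k, Ring.choose n i • Finsupp.single (n + p - i) (mode i u v) := by
  obtain ⟨n₀, hn⟩ := h.truncation u v
  refine ⟨n₀, hn, fun k hk n p => ?_⟩
  refine finsum_eq_sum_of_support_subset _ fun i hi => ?_
  by_contra hlt
  refine hi ?_
  have : n₀ ≤ i := hk.trans (by simpa using hlt)
  simp [hn i this]

theorem mode_D_zero (h : IsDGVertexLieAlgebra N 𝒰 d mode D) (u v : U) : mode 0 (D u) v = 0 := by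
  simpa [Yminus] using h.D_deriv u v (-1)

theorem mode_D_succ (h : IsDGVertexLieAlgebra N 𝒰 d mode D) (n : ℕ) (u v : U) :
    mode (n + 1) (D u) v = -((n : ℤ) + 1) • mode n u v := by
  have key := h.D_deriv u v (-(n : ℤ) - 2)
  have h1 : (-(-(n : ℤ) - 2) - 1).toNat = n + 1 := by omega
  have h2 : (-(-(n : ℤ) - 2 + 1) - 1).toNat = n := by omega
  rw [Yminus, Yminus, if_pos (by omega), if_pos (by omega), h1, h2] at key
  rw [key]
  congr 1
  omega

theorem D_mode (h : IsDGVertexLieAlgebra N 𝒰 d mode D) (n : ℕ) (u v : U) :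
    D (mode n u v) - mode n u (D v) = mode n (D u) v := by
  have key := h.D_comm u v (-(n : ℤ) - 1)
  have h1 : (-(-(n : ℤ) - 1) - 1).toNat = n := by omega
  simpa only [Yminus, if_pos (show (-(n : ℤ) - 1) < 0 by omega), h1] using key

theorem succ_mul_choose (n : ℤ) (i : ℕ) :
    ((i : ℤ) + 1) * Ring.choose n (i + 1) = n * Ring.choose (n - 1) i := by
  have := Ring.choose_smul_choose n (n := i + 1) (k := 1) (by omega)
  simpa using this

theorem sub_mul_choose (n : ℤ) (i : ℕ) :
    (n - i) * Ring.choose n i = n * Ring.choose (n - 1) i := by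
  rw [← succ_mul_choose]
  have := Ring.choose_smul_choose n (n := i + 1) (k := i) (by omega)
  simp at this
  linarith

theorem loopBracket_Dhat_left (h : IsDGVertexLieAlgebra N 𝒰 d mode D) (f g : ℤ →₀ U) :
    h.loopBracket (Dhat D f) g = 0 := by
  induction f using Finsupp.induction_linear with
  | zero => simp
  | add f f' hf hf' => simp [hf, hf']
  | single n u =>
    induction g using Finsupp.induction_linear with
    | zero => simp
    | add g g' hg hg' => rw [map_add, hg, hg', add_zero]
    | single p v =>
      obtain ⟨k, hk, hs⟩ := h.exists_loopTerm_eq_sum u v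
      obtain ⟨k', -, hs'⟩ := h.exists_loopTerm_eq_sum (D u) v
      rw [Dhat_single, map_add, map_smul, LinearMap.add_apply, LinearMap.smul_apply]
      simp only [loopBracket, finsuppBilin_single]
      rw [hs' (max k k' + 1) (by omega), hs (max k k') (by omega), Finset.sum_range_succ',
        h.mode_D_zero, Finset.smul_sum]
      simp only [Finsupp.single_zero, smul_zero, add_zero]
      rw [← Finset.sum_add_distrib]
      refine Finset.sum_eq_zero fun i _ => ?_
      rw [h.mode_D_succ, ← Int.cast_smul_eq_zsmul ℂ, ← Int.cast_smul_eq_zsmul ℂ (Ring.choose _ _),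
        ← Int.cast_smul_eq_zsmul ℂ (-((i : ℤ) + 1)), ← Finsupp.smul_single, smul_smul, smul_smul]
      have e1 : n + p - ((i + 1 : ℕ) : ℤ) = n - 1 + p - i := by push_cast; ring
      rw [e1, ← add_smul]
      have e2 := succ_mul_choose n i
      have e3 : ((Ring.choose n (i + 1) : ℤ) : ℂ) * ((-((i : ℤ) + 1) : ℤ) : ℂ) +
          (n : ℂ) * ((Ring.choose (n - 1) i : ℤ) : ℂ) = 0 := by
        have e4 : (((i : ℤ) + 1 : ℤ) : ℂ) * ((Ring.choose n (i + 1) : ℤ) : ℂ) =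
            (n : ℂ) * ((Ring.choose (n - 1) i : ℤ) : ℂ) := by exact_mod_cast e2
        rw [← e4]
        push_cast
        ring
      rw [e3, zero_smul]

theorem loopBracket_Dhat_right (h : IsDGVertexLieAlgebra N 𝒰 d mode D) (f g : ℤ →₀ U) :
    h.loopBracket f (Dhat D g) = Dhat D (h.loopBracket f g) := by
  induction f using Finsupp.induction_linear with
  | zero => simp
  | add f f' hf hf' => simp [hf, hf']
  | single n u =>
    induction g using Finsupp.induction_linear with
    | zero => simp
    | add g g' hg hg' => simp only [map_add, hg, hg']
    | single p v =>
      have hz := h.loopBracket_Dhat_left (Finsupp.single n u) (Finsupp.single p v)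
      rw [Dhat_single, map_add, map_smul, LinearMap.add_apply, LinearMap.smul_apply] at hz
      rw [Dhat_single, map_add, map_smul]
      simp only [loopBracket, finsuppBilin_single] at hz ⊢
      obtain ⟨k₁, -, hs₁⟩ := h.exists_loopTerm_eq_sum u v
      obtain ⟨k₂, -, hs₂⟩ := h.exists_loopTerm_eq_sum (D u) v
      obtain ⟨k₃, -, hs₃⟩ := h.exists_loopTerm_eq_sum u (D v)
      have l₁ : k₁ ≤ max k₁ (max k₂ k₃) := by omega
      have l₂ : k₂ ≤ max k₁ (max k₂ k₃) := by omega
      have l₃ : k₃ ≤ max k₁ (max k₂ k₃) := by omega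
      generalize max k₁ (max k₂ k₃) = k at l₁ l₂ l₃
      rw [hs₂ k l₂, hs₁ k l₁] at hz
      rw [hs₃ k l₃, hs₁ k l₁, hs₁ k l₁, map_sum]
      rw [← sub_eq_zero, ← neg_eq_zero, ← hz]
      simp only [Finset.smul_sum, map_zsmul, Dhat_single]
      rw [← Finset.sum_add_distrib, ← Finset.sum_add_distrib, ← Finset.sum_sub_distrib,
        ← Finset.sum_neg_distrib]
      refine Finset.sum_congr rfl fun i _ => ?_
      rw [← h.D_mode, Finsupp.single_sub]
      have e1 : n + (p - 1) - (i : ℤ) = n + p - i - 1 := by ring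
      have e2 : n - 1 + p - (i : ℤ) = n + p - i - 1 := by ring
      rw [e1, e2]
      simp only [← Int.cast_smul_eq_zsmul ℂ]
      have e3 : (n : ℂ) * ((Ring.choose (n - 1) i : ℤ) : ℂ) =
          ((n : ℂ) - i) * ((Ring.choose n i : ℤ) : ℂ) := by
        have := sub_mul_choose n i
        exact_mod_cast this.symm
      rw [smul_smul (n : ℂ), e3]
      push_cast
      module

/-- The bracket of `𝓛(U)`: `[u_n, v_p] = ∑_{i ≥ 0} (n choose i) (u_(i) v)_{n + p - i}`. -/
def modeLieBracket (h : IsDGVertexLieAlgebra N 𝒰 d mode D) :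
    ModeLie D →ₗ[ℂ] ModeLie D →ₗ[ℂ] ModeLie D :=
  Submodule.liftQ _
    (LinearMap.flip <| Submodule.liftQ _
      (h.loopBracket.compr₂ (LinearMap.range (Dhat D)).mkQ).flip <| by
        rintro _ ⟨g, rfl⟩
        refine LinearMap.ext fun f => ?_
        simp [h.loopBracket_Dhat_right]) <| by
    rintro _ ⟨f, rfl⟩
    refine LinearMap.ext fun y => ?_
    obtain ⟨g, rfl⟩ := Submodule.mkQ_surjective _ y
    simp [h.loopBracket_Dhat_left]

theorem modeLieBracket_modeOf (h : IsDGVertexLieAlgebra N 𝒰 d mode D) (n p : ℤ) (u v : U) :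
    h.modeLieBracket (modeOf D n u) (modeOf D p v) =
      ∑ᶠ i : ℕ, Ring.choose n i • modeOf D (n + p - i) (mode i u v) := by
  have : h.modeLieBracket (modeOf D n u) (modeOf D p v) =
      (LinearMap.range (Dhat D)).mkQ (h.loopTerm n p u v) := by
    simp [modeLieBracket, modeOf, loopBracket]
  rw [this, loopTerm, LinearMap.mk₂_apply]
  refine ((LinearMap.range (Dhat D)).mkQ.toAddMonoidHom.map_finsum
    (h.finite_support ..)).trans (finsum_congr fun i => ?_)
  exact map_zsmul (LinearMap.range (Dhat D)).mkQ _ _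

end IsDGVertexLieAlgebra

end ModeLie

/-! ### The affine dg Lie algebra `ĝ = g ⊗ ℂ[t, t⁻¹] ⊕ ℂK` -/

section Affine

variable {g : Type*} [AddCommGroup g] [Module ℂ g]

/-- The space `g ⊗ ℂ[t, t⁻¹] ⊕ ℂK`. -/
abbrev Affine (g : Type*) [AddCommGroup g] [Module ℂ g] : Type _ := (ℤ →₀ g) × ℂ

/-- The element `a ⊗ t ^ n` of `ĝ`. -/
def affineOf (n : ℤ) (a : g) : Affine g := (Finsupp.single n a, 0)

/-- The element `K` of `ĝ`. -/
def affineK : Affine g := (0, 1)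

/-- The degree `p` part of `ĝ`, where `|t| = -2N` and `|K| = 2N`. -/
def affineDeg (N : ℤ) (𝒢 : ℤ → Submodule ℂ g) (p : ℤ) : Submodule ℂ (Affine g) :=
  (loopDeg N 𝒢 p).prod (if p = 2 * N then ⊤ else ⊥)

/-- `d (a ⊗ t ^ n) = d a ⊗ t ^ n` and `d K = 0`. -/
def affineD (d : g →ₗ[ℂ] g) : Affine g →ₗ[ℂ] Affine g :=
  (loopD d).prodMap 0

/-- `[a ⊗ t ^ m, b ⊗ t ^ n] = [a, b] ⊗ t ^ (m + n) + m ⟨a, b⟩ δ_{m+n,0} K`, with `K` central. -/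
def affineBracket (br : g →ₗ[ℂ] g →ₗ[ℂ] g) (form : g →ₗ[ℂ] g →ₗ[ℂ] ℂ) :
    Affine g →ₗ[ℂ] Affine g →ₗ[ℂ] Affine g :=
  (finsuppBilin fun m n : ℤ =>
      br.compr₂ ((LinearMap.inl ℂ (ℤ →₀ g) ℂ).comp (Finsupp.lsingle (m + n))) +
        (if m + n = 0 then (m : ℂ) else 0) •
          form.compr₂ (LinearMap.inr ℂ (ℤ →₀ g) ℂ)).compl₁₂
    (LinearMap.fst ℂ (ℤ →₀ g) ℂ) (LinearMap.fst ℂ (ℤ →₀ g) ℂ)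

end Affine

/-! ### The complex `U = ℂ[D] ⊗ g ⊕ ℂK` and its modes -/

section Current

variable {g : Type*} [AddCommGroup g] [Module ℂ g]

/-- The space `ℂ[D] ⊗ g ⊕ ℂK`. -/
abbrev Current (g : Type*) [AddCommGroup g] [Module ℂ g] : Type _ := (ℕ →₀ g) × ℂ

/-- The element `D ^ k a` of `U`. -/
def currentOf (k : ℕ) : g →ₗ[ℂ] Current g :=
  (LinearMap.inl ℂ (ℕ →₀ g) ℂ).comp (Finsupp.lsingle k)

/-- The element `K` of `U`. -/
def currentK : Current g := (0, 1)

/-- The degree `p` part of `U`, where `|D| = 2N` and `|K| = 0`: the coefficient of `D ^ k` has to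
lie in `g^[p - 2Nk]`. -/
def currentDeg (N : ℤ) (𝒢 : ℤ → Submodule ℂ g) (p : ℤ) : Submodule ℂ (Current g) :=
  Submodule.prod
    { carrier := {f | ∀ k : ℕ, f k ∈ 𝒢 (p - 2 * N * k)}
      add_mem' := fun hf hg k => (𝒢 _).add_mem (hf k) (hg k)
      zero_mem' := fun _ => (𝒢 _).zero_mem
      smul_mem' := fun c _ hf k => (𝒢 _).smul_mem c (hf k) }
    (if p = 0 then ⊤ else ⊥)

/-- The differential `d (D ^ k a) = D ^ k (d a)`, `d K = 0`. -/
def currentDiff (d : g →ₗ[ℂ] g) : Current g →ₗ[ℂ] Current g :=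
  (Finsupp.mapRange.linearMap d).prodMap 0

/-- The operator `D (D ^ k a) = D ^ (k + 1) a`, `D K = 0`. -/
def currentD : Current g →ₗ[ℂ] Current g :=
  (Finsupp.lmapDomain g ℂ (fun k : ℕ => k + 1)).prodMap 0

/-- The products of generators: `a_(0) b = [a, b]`, `a_(1) b = ⟨a, b⟩ K` and `a_(n) b = 0` for
`n ≥ 2`. -/
def generatorMode (br : g →ₗ[ℂ] g →ₗ[ℂ] g) (form : g →ₗ[ℂ] g →ₗ[ℂ] ℂ) :
    ℕ → g →ₗ[ℂ] g →ₗ[ℂ] Current g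
  | 0 => br.compr₂ (currentOf 0)
  | 1 => form.compr₂ (LinearMap.inr ℂ (ℕ →₀ g) ℂ)
  | _ + 2 => 0

/-- The modes of `U`. With `D^(k) = D ^ k / k!`, they are determined by the products of generators,
by `K_(n) = 0` and `u_(n) K = 0`, and by
`((-D)^(k) a)_(n) = (n choose k) a_(n-k)` and
`a_(n) (D^(l) b) = ∑_{i=0}^{l} (n choose i) D^(l-i) (a_(n-i) b)`;
the resulting value of `(D ^ k a)_(n) (D ^ l b)` is written out here. -/
def currentMode (br : g →ₗ[ℂ] g →ₗ[ℂ] g) (form : g →ₗ[ℂ] g →ₗ[ℂ] ℂ) (n : ℕ) :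
    Current g →ₗ[ℂ] Current g →ₗ[ℂ] Current g :=
  (finsuppBilin fun k l : ℕ =>
      ((-1 : ℂ) ^ k * k.factorial * l.factorial * n.choose k) •
        ∑ i ∈ Finset.range (l + 1), (((n - k).choose i : ℂ) * ((l - i).factorial : ℂ)⁻¹) •
          (generatorMode br form (n - k - i)).compr₂ (currentD ^ (l - i))).compl₁₂
    (LinearMap.fst ℂ (ℕ →₀ g) ℂ) (LinearMap.fst ℂ (ℕ →₀ g) ℂ)

theorem currentMode_generators (br : g →ₗ[ℂ] g →ₗ[ℂ] g) (form : g →ₗ[ℂ] g →ₗ[ℂ] ℂ) (n : ℕ)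
    (a b : g) :
    currentMode br form n (currentOf 0 a) (currentOf 0 b) = generatorMode br form n a b := by
  simp [currentMode, currentOf]

theorem currentMode_K_left (br : g →ₗ[ℂ] g →ₗ[ℂ] g) (form : g →ₗ[ℂ] g →ₗ[ℂ] ℂ) (n : ℕ)
    (v : Current g) : currentMode br form n currentK v = 0 := by
  simp [currentMode, currentK]

theorem currentMode_K_right (br : g →ₗ[ℂ] g →ₗ[ℂ] g) (form : g →ₗ[ℂ] g →ₗ[ℂ] ℂ) (n : ℕ)
    (u : Current g) : currentMode br form n u currentK = 0 := by
  simp [currentMode, currentK]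

theorem currentD_pow_currentOf (k : ℕ) (a : g) :
    (currentD ^ k) (currentOf 0 a) = currentOf k a := by
  induction k with
  | zero => simp
  | succ k ih =>
    rw [pow_succ', Module.End.mul_apply, ih]
    simp [currentD, currentOf]

/-- `((-D)^(k) a)_(n) = (n choose k) a_(n-k)`. -/
theorem currentMode_D_left (br : g →ₗ[ℂ] g →ₗ[ℂ] g) (form : g →ₗ[ℂ] g →ₗ[ℂ] ℂ) (n k : ℕ)
    (a : g) :
    currentMode br form n (((k.factorial : ℂ)⁻¹) • ((-currentD) ^ k) (currentOf 0 a)) =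
      (n.choose k : ℂ) • currentMode br form (n - k) (currentOf 0 a) := by
  have hk : (k.factorial : ℂ) ≠ 0 := by exact_mod_cast k.factorial_ne_zero
  have e : ((-currentD) ^ k) (currentOf 0 a) = (-1 : ℂ) ^ k • currentOf k a := by
    have e' : (-currentD : Current g →ₗ[ℂ] Current g) = (-1 : ℂ) • currentD := (neg_one_smul ℂ _).symm
    rw [e', smul_pow, LinearMap.smul_apply, currentD_pow_currentOf]
  rw [e]
  refine LinearMap.ext fun v => ?_
  obtain ⟨f, c⟩ := v
  induction f using Finsupp.induction_linear with
  | zero => simp [currentMode]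
  | add f f' hf hf' =>
    have : ((f + f', c) : Current g) = (f, c) + (f', c) - (0, c) := by simp
    rw [this, map_sub, map_add, map_sub, map_add, hf, hf']
    simp [currentMode]
  | single l b =>
    simp only [currentMode, currentOf, map_smul, LinearMap.smul_apply, LinearMap.compl₁₂_apply,
      LinearMap.comp_apply, LinearMap.fst_apply, LinearMap.inl_apply, Finsupp.lsingle_apply,
      finsuppBilin_single, smul_smul, Nat.sub_zero]
    congr 1
    have h2 : ((-1 : ℂ) ^ k) * (-1) ^ k = 1 := by rw [← mul_pow]; simp
    simp only [pow_zero, Nat.factorial_zero, Nat.cast_one, Nat.choose_zero_right, one_mul, mul_one]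
    field_simp
    linear_combination ((l.factorial : ℂ) * n.choose k) * h2

/-- `a_(n) (D^(l) b) = ∑_{i=0}^{l} (n choose i) D^(l-i) (a_(n-i) b)`. -/
theorem currentMode_D_right (br : g →ₗ[ℂ] g →ₗ[ℂ] g) (form : g →ₗ[ℂ] g →ₗ[ℂ] ℂ) (n l : ℕ)
    (a b : g) :
    currentMode br form n (currentOf 0 a)
        (((l.factorial : ℂ)⁻¹) • (currentD ^ l) (currentOf 0 b)) =
      ∑ i ∈ Finset.range (l + 1), (n.choose i : ℂ) • (((l - i).factorial : ℂ)⁻¹) •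
        (currentD ^ (l - i)) (currentMode br form (n - i) (currentOf 0 a) (currentOf 0 b)) := by
  have hl : (l.factorial : ℂ) ≠ 0 := by exact_mod_cast l.factorial_ne_zero
  simp only [currentMode_generators, currentD_pow_currentOf]
  simp [currentMode, currentOf, smul_smul, LinearMap.sum_apply, hl]

end Current

end DGVertex

end

open DGVertex

/-!
Translation covariance, `(D u)_(n) = -n u_(n-1)` and `[D, u_(n)] = n u_(n-1)`, makes every axiom
of a dg vertex Lie algebra stable under `D`, so that on `ℂ[D] ⊗ g ⊕ ℂK` it suffices to verify them
on `g`, where only the products with `n = 0, 1` are nonzero and the axioms are those of a dg Lie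
algebra with an invariant form.

The half Jacobi identity follows from the commutator formula
`[u_(m), v_(n)] = ∑ᵢ (m choose i) (u_(i) v)_(m + n - i)`. Indeed, with `F i j = (u_(i) v)_(j) w`
viewed as the singular series `F(x, y)`, the right-hand side applied to `w` is the singular part of
`F(x - y, y)`, and the residue of `x ^ l (x + y) ^ m F(x, y)` in `x` is recovered from it by
multiplying with `(x - y) ^ l`. Stability of the commutator formula under `D` is the chain rule for
this change of variables.

In `𝓛(U)` the relation `(D u)_n = -n u_(n-1)` shows that the classes `a_n` with `a ∈ g` and
`K_(-1)` span, which gives the inverse `ĝ → 𝓛(U)` of the linear map `𝓛(U) → ĝ`. The two brackets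
agree since `[a_n, b_p]` only involves `a_(0) b` and `a_(1) b`, and `𝓛(U)` inherits the dg Lie
algebra axioms from `ĝ`.
-/

noncomputable section

namespace DGVertex

/-! ### Signs -/

section Signs

variable {K : Type*} [DivisionRing K]

theorem neg_one_zpow_congr {x y : ℤ} (h : Even (x - y)) : (-1 : K) ^ x = (-1 : K) ^ y := by
  rw [show x = x - y + y by ring, zpow_add₀ (by simp), h.neg_one_zpow, one_mul]

theorem neg_one_zpow_add_two_mul (p a : ℤ) : (-1 : K) ^ (p + 2 * a) = (-1 : K) ^ p :=
  neg_one_zpow_congr ⟨a, by ring⟩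

theorem neg_one_zpow_add_two_mul_mul (p q a : ℤ) :
    (-1 : K) ^ ((p + 2 * a) * q) = (-1 : K) ^ (p * q) :=
  neg_one_zpow_congr ⟨a * q, by ring⟩

theorem neg_one_zpow_mul_add_two_mul (p q a : ℤ) :
    (-1 : K) ^ (p * (q + 2 * a)) = (-1 : K) ^ (p * q) :=
  neg_one_zpow_congr ⟨p * a, by ring⟩

theorem neg_one_zpow_add_two_mul_mul_add_two_mul (p q a b : ℤ) :
    (-1 : K) ^ ((p + 2 * a) * (q + 2 * b)) = (-1 : K) ^ (p * q) :=
  (neg_one_zpow_add_two_mul_mul ..).trans (neg_one_zpow_mul_add_two_mul ..)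

end Signs

/-! ### Internal gradings -/

section Internal

variable {R V W ι κ : Type*} [Ring R] [AddCommGroup V] [Module R V] [AddCommGroup W] [Module R W]

theorem iSup_le_comap_iSup {ι : Sort*} {f : V →ₗ[R] W} {𝒱 : ι → Submodule R V}
    {𝒲 : ι → Submodule R W} (h : ∀ i, 𝒱 i ≤ (𝒲 i).comap f) :
    ⨆ i, 𝒱 i ≤ (⨆ i, 𝒲 i).comap f :=
  iSup_le fun i => (h i).trans (Submodule.comap_mono (le_iSup 𝒲 i))

variable [DecidableEq ι]

theorem isInternal_comp_equiv {𝒱 : ι → Submodule R V} (h : DirectSum.IsInternal 𝒱)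
    (e : Equiv.Perm ι) : DirectSum.IsInternal fun i => 𝒱 (e i) := by
  rw [DirectSum.isInternal_submodule_iff_iSupIndep_and_iSup_eq_top] at h ⊢
  exact ⟨h.1.comp e.injective, e.iSup_comp.trans h.2⟩

theorem isInternal_comap_equiv {𝒲 : ι → Submodule R W} (h : DirectSum.IsInternal 𝒲)
    (φ : V ≃ₗ[R] W) : DirectSum.IsInternal fun i => (𝒲 i).comap (φ : V →ₗ[R] W) := by
  rw [DirectSum.isInternal_submodule_iff_iSupIndep_and_iSup_eq_top] at h ⊢
  let Φ : Submodule R W ≃o Submodule R V := (Submodule.orderIsoMapComap φ).symm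
  exact ⟨h.1.map_orderIso Φ, (Φ.map_iSup 𝒲).symm.trans (by rw [h.2, Φ.map_top])⟩

theorem isInternal_finsupp {𝒱 : κ → ι → Submodule R V}
    (h : ∀ k, DirectSum.IsInternal (𝒱 k)) :
    DirectSum.IsInternal fun i => Finsupp.submodule fun k => 𝒱 k i := by
  simp only [DirectSum.isInternal_submodule_iff_iSupIndep_and_iSup_eq_top] at h ⊢
  refine ⟨fun i => Submodule.disjoint_def.2 fun f hf hf' => Finsupp.ext fun k => ?_, ?_⟩
  · have hle : (⨆ (j) (_ : j ≠ i), Finsupp.submodule fun k => 𝒱 k j) ≤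
        (⨆ (j) (_ : j ≠ i), 𝒱 k j).comap (Finsupp.lapply k) :=
      iSup_le_comap_iSup fun j => iSup_le_comap_iSup fun _ f hf => hf k
    exact Submodule.disjoint_def.1 ((h k).1 i) _ (hf k) (hle hf')
  · simp only [Finsupp.submodule_eq_iSup]
    rw [iSup_comm]
    simp only [← Submodule.map_iSup, (h _).2]
    rw [← Finsupp.submodule_eq_iSup, Finsupp.submodule_top]

theorem isInternal_prod {𝒱 : ι → Submodule R V} {𝒲 : ι → Submodule R W}
    (hV : DirectSum.IsInternal 𝒱) (hW : DirectSum.IsInternal 𝒲) :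
    DirectSum.IsInternal fun i => (𝒱 i).prod (𝒲 i) := by
  rw [DirectSum.isInternal_submodule_iff_iSupIndep_and_iSup_eq_top] at hV hW ⊢
  refine ⟨fun i => Submodule.disjoint_def.2 fun x hx hx' => ?_, eq_top_iff.2 fun x _ => ?_⟩
  · have h₁ : (⨆ (j) (_ : j ≠ i), (𝒱 j).prod (𝒲 j)) ≤
        (⨆ (j) (_ : j ≠ i), 𝒱 j).comap (LinearMap.fst R V W) :=
      iSup_le_comap_iSup fun j => iSup_le_comap_iSup fun _ x hx => hx.1
    have h₂ : (⨆ (j) (_ : j ≠ i), (𝒱 j).prod (𝒲 j)) ≤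
        (⨆ (j) (_ : j ≠ i), 𝒲 j).comap (LinearMap.snd R V W) :=
      iSup_le_comap_iSup fun j => iSup_le_comap_iSup fun _ x hx => hx.2
    exact Prod.ext (Submodule.disjoint_def.1 (hV.1 i) _ hx.1 (h₁ hx'))
      (Submodule.disjoint_def.1 (hW.1 i) _ hx.2 (h₂ hx'))
  · have h₁ : ⨆ i, 𝒱 i ≤ (⨆ i, (𝒱 i).prod (𝒲 i)).comap (LinearMap.inl R V W) :=
      iSup_le_comap_iSup fun i v hv => ⟨hv, Submodule.zero_mem _⟩
    have h₂ : ⨆ i, 𝒲 i ≤ (⨆ i, (𝒱 i).prod (𝒲 i)).comap (LinearMap.inr R V W) :=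
      iSup_le_comap_iSup fun i w hw => ⟨Submodule.zero_mem _, hw⟩
    rw [hV.2] at h₁
    rw [hW.2] at h₂
    have hx₁ := h₁ (Submodule.mem_top (x := x.1))
    have hx₂ := h₂ (Submodule.mem_top (x := x.2))
    simpa using add_mem (Submodule.mem_comap.1 hx₁) (Submodule.mem_comap.1 hx₂)

theorem isInternal_concentrated (r : ι) :
    DirectSum.IsInternal fun i : ι => (if i = r then ⊤ else ⊥ : Submodule R V) := by
  rw [DirectSum.isInternal_submodule_iff_iSupIndep_and_iSup_eq_top]
  refine ⟨fun i => ?_, eq_top_iff.2 (le_iSup_of_le r (by simp))⟩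
  by_cases hi : i = r
  · have : (⨆ (j) (_ : j ≠ i), (if j = r then ⊤ else ⊥ : Submodule R V)) = ⊥ := by
      simp only [iSup_eq_bot]
      exact fun j hj => if_neg (hi ▸ hj)
    rw [this]
    exact disjoint_bot_right
  · simp only [if_neg hi, disjoint_bot_left]

end Internal

/-! ### Operators on singular parts of series -/

theorem pow_mul_of_mul_eq_mul_add_one {S : Type*} [Semiring S] {A P : S}
    (h : A * P = P * A + 1) (m : ℕ) : A ^ m * P = P * A ^ m + m • A ^ (m - 1) := by
  induction m with
  | zero => simp
  | succ m ih =>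
    rw [pow_succ, mul_assoc, h, mul_add, ← mul_assoc, ih, add_mul, smul_mul_assoc, mul_assoc,
      ← pow_succ, mul_one, Nat.add_sub_cancel]
    rcases m with _ | m
    · simp
    · rw [Nat.add_sub_cancel, ← pow_succ, add_assoc, ← succ_nsmul]

section OneVariable

variable (R : Type*) {M : Type*} [Semiring R] [AddCommMonoid M] [Module R M]

/-- Multiplication by `x` on singular parts, where `f : ℕ → M` stands for the singular part
`∑ₙ f n x ^ (-n-1)` of a series in `x`. -/
def mulX : Module.End R (ℕ → M) := LinearMap.funLeft R M Nat.succ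

/-- The operator `-d/dx` on singular parts `∑ₙ f n x ^ (-n-1)`. -/
def negDeriv : Module.End R (ℕ → M) where
  toFun f n := n • f (n - 1)
  map_add' _ _ := funext fun _ => smul_add ..
  map_smul' _ _ := funext fun _ => smul_comm ..

@[simp]
theorem mulX_apply (f : ℕ → M) (n : ℕ) : mulX R f n = f (n + 1) := rfl

@[simp]
theorem negDeriv_apply (f : ℕ → M) (n : ℕ) : negDeriv R f n = n • f (n - 1) := rfl

theorem mulX_pow_apply (k : ℕ) (f : ℕ → M) (n : ℕ) : (mulX R ^ k) f n = f (n + k) := by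
  induction k generalizing n with
  | zero => rfl
  | succ k ih => rw [pow_succ', Module.End.mul_apply, mulX_apply, ih, add_right_comm, add_assoc]

theorem negDeriv_pow_apply (k : ℕ) (f : ℕ → M) (n : ℕ) :
    (negDeriv R ^ k) f n = n.descFactorial k • f (n - k) := by
  induction k generalizing n with
  | zero => simp
  | succ k ih =>
    rw [pow_succ', Module.End.mul_apply, negDeriv_apply, ih]
    rcases n with _ | n
    · simp
    · rw [Nat.succ_descFactorial_succ, mul_smul, Nat.add_sub_cancel, Nat.add_sub_add_right]

theorem mulX_mul_negDeriv :
    (mulX R * negDeriv R : Module.End R (ℕ → M)) = negDeriv R * mulX R + 1 := by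
  refine LinearMap.ext fun f => funext fun n => ?_
  rcases n with _ | n <;> simp [add_smul]

theorem compLeft_pow_apply (T : Module.End R M) (k : ℕ) (f : ℕ → M) (n : ℕ) :
    (T.compLeft ℕ ^ k) f n = (T ^ k) (f n) := by
  induction k with
  | zero => rfl
  | succ k ih => rw [pow_succ', Module.End.mul_apply, LinearMap.compLeft_apply, pow_succ',
      Module.End.mul_apply, ← ih, Function.comp_apply]

theorem commute_mulX_compLeft (T : Module.End R M) : Commute (mulX R) (T.compLeft ℕ) := rfl

theorem commute_negDeriv_compLeft (T : Module.End R M) :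
    Commute (negDeriv R) (T.compLeft ℕ) :=
  LinearMap.ext fun _ => funext fun _ => (map_nsmul T _ _).symm

theorem negDeriv_add_compLeft_pow_apply (T : Module.End R M) (l : ℕ) (f : ℕ → M) (n : ℕ) :
    ((negDeriv R + T.compLeft ℕ) ^ l : Module.End R (ℕ → M)) f n = ∑ i ∈ Finset.range (l + 1),
      (l.choose i * n.descFactorial i) • (T ^ (l - i)) (f (n - i)) := by
  rw [(commute_negDeriv_compLeft R T).add_pow, LinearMap.sum_apply, Finset.sum_apply]
  refine Finset.sum_congr rfl fun i _ => ?_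
  rw [← nsmul_eq_mul', LinearMap.smul_apply, Pi.smul_apply, Module.End.mul_apply,
    negDeriv_pow_apply, compLeft_pow_apply, mul_smul]

end OneVariable

section TwoVariables

variable (R : Type*) {M : Type*} [Ring R] [AddCommGroup M] [Module R M]

/-- Multiplication by `x` on singular parts `∑ᵢⱼ F i j x ^ (-i-1) y ^ (-j-1)`. -/
abbrev mulFst : Module.End R (ℕ → ℕ → M) := mulX R

/-- Multiplication by `y` on singular parts `∑ᵢⱼ F i j x ^ (-i-1) y ^ (-j-1)`. -/
abbrev mulSnd : Module.End R (ℕ → ℕ → M) := (mulX R).compLeft ℕ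

/-- The operator `-∂/∂x` on singular parts `∑ᵢⱼ F i j x ^ (-i-1) y ^ (-j-1)`. -/
abbrev negDerivFst : Module.End R (ℕ → ℕ → M) := negDeriv R

/-- The operator `-∂/∂y` on singular parts `∑ᵢⱼ F i j x ^ (-i-1) y ^ (-j-1)`. -/
abbrev negDerivSnd : Module.End R (ℕ → ℕ → M) := (negDeriv R).compLeft ℕ

/-- Multiplication by `x + y` on singular parts `∑ᵢⱼ F i j x ^ (-i-1) y ^ (-j-1)`. -/
def mulAdd : Module.End R (ℕ → ℕ → M) := mulFst R + mulSnd R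

/-- Multiplication by `x - y` on singular parts `∑ᵢⱼ F i j x ^ (-i-1) y ^ (-j-1)`. -/
def mulSub : Module.End R (ℕ → ℕ → M) := mulFst R - mulSnd R

@[simp]
theorem mulAdd_apply (F : ℕ → ℕ → M) (i j : ℕ) :
    mulAdd R F i j = F (i + 1) j + F i (j + 1) := rfl

@[simp]
theorem mulSub_apply (F : ℕ → ℕ → M) (i j : ℕ) :
    mulSub R F i j = F (i + 1) j - F i (j + 1) := rfl

theorem commute_mulFst_mulSnd :
    Commute (mulFst R) (mulSnd R : Module.End R (ℕ → ℕ → M)) :=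
  commute_mulX_compLeft R (mulX R)

theorem mulAdd_pow_apply (m : ℕ) (F : ℕ → ℕ → M) (l n : ℕ) :
    (mulAdd R ^ m) F l n =
      ∑ i ∈ Finset.range (m + 1), m.choose i • F (l + i) (n + (m - i)) := by
  rw [mulAdd, (commute_mulFst_mulSnd R).add_pow, LinearMap.sum_apply, Finset.sum_apply,
    Finset.sum_apply]
  refine Finset.sum_congr rfl fun i _ => ?_
  rw [Module.End.mul_apply, Module.End.mul_apply, Module.End.natCast_apply, map_nsmul, map_nsmul,
    Pi.smul_apply, Pi.smul_apply, mulX_pow_apply, compLeft_pow_apply, mulX_pow_apply]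

theorem mulSub_pow_apply (l : ℕ) (G : ℕ → ℕ → M) (m n : ℕ) :
    (mulSub R ^ l) G m n =
      ∑ i ∈ Finset.range (l + 1), ((-1) ^ i * l.choose i : ℤ) • G (m + (l - i)) (n + i) := by
  have hcomm : Commute (-mulSnd R) (mulFst R : Module.End R (ℕ → ℕ → M)) :=
    (commute_mulFst_mulSnd R (M := M)).symm.neg_left
  rw [mulSub, sub_eq_neg_add, hcomm.add_pow,
    LinearMap.sum_apply, Finset.sum_apply, Finset.sum_apply]
  refine Finset.sum_congr rfl fun i _ => ?_
  rw [neg_pow (mulSnd R (M := M)), Module.End.mul_apply, Module.End.mul_apply, Module.End.mul_apply,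
    Module.End.natCast_apply, mul_smul, natCast_zsmul, map_nsmul, map_nsmul, map_nsmul]
  rcases Nat.even_or_odd i with hi | hi <;>
    simp [hi.neg_one_pow, compLeft_pow_apply, mulX_pow_apply]

theorem mulSub_pow_swap (l : ℕ) (H : ℕ → ℕ → M) (m n : ℕ) :
    (mulSub R ^ l) (fun i j => H j i) m n =
      (-1 : ℤ) ^ l • (mulSub R ^ l) H n m := by
  induction l generalizing H with
  | zero => simp
  | succ l ih =>
    have hswap : mulSub R (fun i j => H j i) =
        fun i j => (-mulSub R H) j i := by
      ext i j
      simp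
    rw [pow_succ, Module.End.mul_apply, hswap, ih, map_neg, Module.End.mul_apply, pow_succ]
    simp

/-- The singular part of `F(x - y, y)`, expanded in nonnegative powers of `y`, for a singular
series `F(x, y) = ∑ᵢⱼ F i j x ^ (-i-1) y ^ (-j-1)`. Substituting
`x + y` for `x`, its residue against `x ^ m` is the residue in `x` of `(x + y) ^ m F(x, y)`. -/
def expandDiff : Module.End R (ℕ → ℕ → M) :=
  LinearMap.pi fun m => LinearMap.proj 0 ∘ₗ mulAdd R ^ m

theorem expandDiff_apply (F : ℕ → ℕ → M) (m n : ℕ) :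
    expandDiff R F m n = (mulAdd R ^ m) F 0 n := rfl

theorem expandDiff_apply_eq_sum (F : ℕ → ℕ → M) (m n : ℕ) :
    expandDiff R F m n = ∑ i ∈ Finset.range (m + 1), m.choose i • F i (n + (m - i)) := by
  simp only [expandDiff_apply, mulAdd_pow_apply, zero_add]

theorem mulAdd_pow_apply_eq (F : ℕ → ℕ → M) (l m n : ℕ) :
    (mulAdd R ^ m) F l n = (mulSub R ^ l) (expandDiff R F) m n := by
  induction l generalizing m n with
  | zero => rfl
  | succ l ih =>
    have hsplit : (mulAdd R ^ m) F (l + 1) n =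
        (mulAdd R ^ (m + 1)) F l n - (mulAdd R ^ m) F l (n + 1) := by
      rw [pow_succ', Module.End.mul_apply]
      simp
    rw [hsplit, ih, ih, pow_succ', Module.End.mul_apply]
    simp

theorem expandDiff_negDerivFst (F : ℕ → ℕ → M) :
    expandDiff R (negDerivFst R F) = negDerivFst R (expandDiff R F) := by
  have hweyl : mulAdd R * negDerivFst R =
      (negDerivFst R * mulAdd R + 1 : Module.End R (ℕ → ℕ → M)) := by
    rw [mulAdd, add_mul, mul_add, mulX_mul_negDeriv,
      ← (commute_negDeriv_compLeft R (mulX R)).eq]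
    abel
  ext m n
  rw [expandDiff_apply, ← Module.End.mul_apply, pow_mul_of_mul_eq_mul_add_one hweyl]
  simp [expandDiff_apply]

theorem expandDiff_negDerivSnd (F : ℕ → ℕ → M) :
    expandDiff R (negDerivSnd R F) =
      negDerivFst R (expandDiff R F) + negDerivSnd R (expandDiff R F) := by
  have hweylSnd : mulSnd R * negDerivSnd R =
      (negDerivSnd R * mulSnd R + 1 : Module.End R (ℕ → ℕ → M)) :=
    LinearMap.ext fun F => funext fun i => LinearMap.congr_fun (mulX_mul_negDeriv R) (F i)
  have hweyl : mulAdd R * negDerivSnd R =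
      (negDerivSnd R * mulAdd R + 1 : Module.End R (ℕ → ℕ → M)) := by
    rw [mulAdd, add_mul, mul_add, hweylSnd, (commute_mulX_compLeft R (negDeriv R)).eq, add_assoc]
  ext m n
  rw [expandDiff_apply, ← Module.End.mul_apply, pow_mul_of_mul_eq_mul_add_one hweyl]
  simp [expandDiff_apply, add_comm]

theorem expandDiff_compLeft (T : Module.End R M) (F : ℕ → ℕ → M) :
    expandDiff R ((T.compLeft ℕ).compLeft ℕ F) = (T.compLeft ℕ).compLeft ℕ (expandDiff R F) := by
  have hcomm : Commute (mulAdd R) ((T.compLeft ℕ).compLeft ℕ) :=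
    (commute_mulX_compLeft R (T.compLeft ℕ)).add_left rfl
  ext m n
  rw [expandDiff_apply, ← Module.End.mul_apply, (hcomm.pow_left m).eq]
  rfl

end TwoVariables

/-! ### The exponential of a translation operator -/

section SkewTransform

open Filter

variable {K U : Type*} [Field K] [AddCommGroup U] [Module K U] (D : U →ₗ[K] U) {f g : ℕ → U}

/-- The coefficients of the singular part of `e ^ (x D) f(-x)`, for a singular part
`f(x) = ∑ₙ f n x ^ (-n-1)`. The sum is only meaningful when `f n = 0` for large `n`. -/
def skewTransform (f : ℕ → U) (n : ℕ) : U :=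
  ∑ᶠ k : ℕ, (((-1) ^ (n + k + 1) / k.factorial : K)) • (D ^ k) (f (n + k))

theorem skewTransform_apply_eq_sum {M : ℕ} (hf : ∀ n, M ≤ n → f n = 0) (n : ℕ) :
    skewTransform D f n =
      ∑ k ∈ Finset.range M, (((-1) ^ (n + k + 1) / k.factorial : K)) • (D ^ k) (f (n + k)) := by
  refine finsum_eq_sum_of_support_subset _ fun k hk => ?_
  by_contra hlt
  have hle : M ≤ k := by simpa using hlt
  exact hk (by simp [hf (n + k) (by omega)])

theorem skewTransform_add (hf : ∀ᶠ n in atTop, f n = 0) (hg : ∀ᶠ n in atTop, g n = 0) :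
    skewTransform D (f + g) = skewTransform D f + skewTransform D g := by
  obtain ⟨M, hM⟩ := eventually_atTop.1 (hf.and hg)
  have hfg : ∀ n, M ≤ n → (f + g) n = 0 := fun n hn => by simp [hM n hn]
  ext n
  simp only [Pi.add_apply, skewTransform_apply_eq_sum D fun n hn => (hM n hn).1,
    skewTransform_apply_eq_sum D fun n hn => (hM n hn).2,
    skewTransform_apply_eq_sum D hfg, map_add, smul_add, Finset.sum_add_distrib]

theorem skewTransform_neg : skewTransform D (-f) = -skewTransform D f := by
  ext n
  simp only [skewTransform, Pi.neg_apply, map_neg, smul_neg, finsum_neg_distrib]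

theorem skewTransform_compLeft (hf : ∀ᶠ n in atTop, f n = 0) :
    skewTransform D (D.compLeft ℕ f) = D.compLeft ℕ (skewTransform D f) := by
  obtain ⟨M, hf⟩ := eventually_atTop.1 hf
  ext n
  have hDf : ∀ n, M ≤ n → D.compLeft ℕ f n = 0 := fun n hn => by simp [hf n hn]
  rw [LinearMap.compLeft_apply, Function.comp_apply, skewTransform_apply_eq_sum D hf,
    skewTransform_apply_eq_sum D hDf, map_sum]
  refine Finset.sum_congr rfl fun k _ => ?_
  rw [map_smul, ← Module.End.mul_apply D, ← pow_succ', pow_succ D, Module.End.mul_apply]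
  rfl

theorem succ_div_factorial_succ (K : Type*) [Field K] [CharZero K] (k : ℕ) :
    (k + 1 : K) / (k + 1).factorial = 1 / k.factorial := by
  have hk : ((k + 1).factorial : K) ≠ 0 := Nat.cast_ne_zero.2 (k + 1).factorial_ne_zero
  have hk' : (k.factorial : K) ≠ 0 := Nat.cast_ne_zero.2 k.factorial_ne_zero
  rw [div_eq_div_iff hk hk', Nat.factorial_succ]
  push_cast
  ring

theorem skewTransform_negDeriv [CharZero K] (hf : ∀ᶠ n in atTop, f n = 0) :
    skewTransform D (negDeriv K f) =
      -(D.compLeft ℕ (skewTransform D f) + negDeriv K (skewTransform D f)) := by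
  obtain ⟨M, hf⟩ := eventually_atTop.1 hf
  ext n
  have hf' : ∀ n, M + 1 ≤ n → f n = 0 := fun n hn => hf n (by omega)
  have hLf : ∀ n, M + 1 ≤ n → negDeriv K f n = 0 := fun n hn => by simp [hf (n - 1) (by omega)]
  rw [skewTransform_apply_eq_sum D hLf, Pi.neg_apply, Pi.add_apply, LinearMap.compLeft_apply,
    Function.comp_apply, skewTransform_apply_eq_sum D hf, negDeriv_apply,
    skewTransform_apply_eq_sum D hf', Finset.sum_range_succ', Finset.sum_range_succ', map_sum,
    smul_add, ← add_assoc, neg_add, Finset.smul_sum, ← Finset.sum_add_distrib,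
    ← Finset.sum_neg_distrib]
  congr 1
  · refine Finset.sum_congr rfl fun k _ => ?_
    rw [negDeriv_apply, map_nsmul, map_smul D, ← Module.End.mul_apply D, ← pow_succ']
    simp only [← Nat.cast_smul_eq_nsmul K, smul_smul]
    rcases n with _ | n
    · rw [show 0 + (k + 1) - 1 = 0 + k by omega]
      simp only [Nat.cast_zero, zero_mul, zero_smul, add_zero, ← neg_smul]
      congr 1
      push_cast
      linear_combination (-1 : K) ^ (0 + (k + 1) + 1) * succ_div_factorial_succ K k
    · rw [show n + 1 + (k + 1) - 1 = n + 1 + k by omega,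
        show n + 1 - 1 + (k + 1) = n + 1 + k by omega, ← add_smul, ← neg_smul]
      congr 1
      push_cast
      linear_combination (-1 : K) ^ (n + 1 + (k + 1) + 1) * succ_div_factorial_succ K k
  · rcases n with _ | n
    · simp
    · simp only [add_zero, pow_zero, Module.End.one_apply, Nat.factorial_zero,
        Nat.cast_one, div_one, negDeriv_apply, Nat.add_sub_cancel, pow_succ _ (n + 1), mul_neg_one,
        neg_smul, smul_comm (n + 1)]

end SkewTransform

/-! ### Translation covariant products -/

section TranslationCovariant

variable {R U : Type*} [CommRing R] [AddCommGroup U] [Module R U]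

/-- Translation covariance of the products `mode n u v = u_(n) v` with respect to `D`:
`Y⁻(D u, x) = d/dx Y⁻(u, x)` and `[D, Y⁻(u, x)] = d/dx Y⁻(u, x)`, read off coefficientwise. -/
structure IsTranslationCovariant (mode : ℕ → U →ₗ[R] U →ₗ[R] U) (D : U →ₗ[R] U) : Prop where
  left : ∀ n u v, mode n (D u) v = -(n • mode (n - 1) u v)
  right : ∀ n u v, mode n u (D v) = D (mode n u v) + n • mode (n - 1) u v

/-- The family `(u_(i) v)_(j) w`. -/
def iterateModes (mode : ℕ → U →ₗ[R] U →ₗ[R] U) (u v w : U) (i j : ℕ) : U :=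
  mode j (mode i u v) w

/-- The family `u_(m) v_(n) w - ε v_(n) u_(m) w`: the graded commutator of modes, for the sign `ε`
of the transposition of `u` and `v`. -/
def modeCommutator (ε : R) (mode : ℕ → U →ₗ[R] U →ₗ[R] U) (u v w : U) (m n : ℕ) : U :=
  mode m u (mode n v w) - ε • mode n v (mode m u w)

/-- The commutator formula `[u_(m), v_(n)] w = ∑ᵢ (m choose i) (u_(i) v)_(m + n - i) w`. -/
def CommutatorFormula (ε : R) (mode : ℕ → U →ₗ[R] U →ₗ[R] U) (u v w : U) : Prop :=
  modeCommutator ε mode u v w = expandDiff R (iterateModes mode u v w)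

variable {mode : ℕ → U →ₗ[R] U →ₗ[R] U} {D : U →ₗ[R] U} {ε : R} {u v w u' v' w' : U}

theorem CommutatorFormula.add_left (h : CommutatorFormula ε mode u v w)
    (h' : CommutatorFormula ε mode u' v w) : CommutatorFormula ε mode (u + u') v w := by
  have hF : iterateModes mode (u + u') v w =
      iterateModes mode u v w + iterateModes mode u' v w := by
    ext i j
    simp [iterateModes]
  rw [CommutatorFormula, hF, map_add, ← h, ← h']
  ext m n
  simp only [modeCommutator, Pi.add_apply, map_add, LinearMap.add_apply, smul_add]
  abel

theorem CommutatorFormula.add_mid (h : CommutatorFormula ε mode u v w)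
    (h' : CommutatorFormula ε mode u v' w) : CommutatorFormula ε mode u (v + v') w := by
  have hF : iterateModes mode u (v + v') w =
      iterateModes mode u v w + iterateModes mode u v' w := by
    ext i j
    simp [iterateModes]
  rw [CommutatorFormula, hF, map_add, ← h, ← h']
  ext m n
  simp only [modeCommutator, Pi.add_apply, map_add, LinearMap.add_apply, smul_add]
  abel

theorem CommutatorFormula.add_right (h : CommutatorFormula ε mode u v w)
    (h' : CommutatorFormula ε mode u v w') : CommutatorFormula ε mode u v (w + w') := by
  have hF : iterateModes mode u v (w + w') =
      iterateModes mode u v w + iterateModes mode u v w' := by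
    ext i j
    simp [iterateModes]
  rw [CommutatorFormula, hF, map_add, ← h, ← h']
  ext m n
  simp only [modeCommutator, Pi.add_apply, map_add, smul_add]
  abel

namespace IsTranslationCovariant

variable (hD : IsTranslationCovariant mode D)
include hD

theorem translate_left_eq_negDeriv (u v : U) :
    (fun n => mode n (D u) v) = -negDeriv R fun n => mode n u v :=
  funext fun n => hD.left n u v

theorem translate_right_eq_add_negDeriv (u v : U) :
    (fun n => mode n u (D v)) =
      D.compLeft ℕ (fun n => mode n u v) + negDeriv R fun n => mode n u v :=
  funext fun n => hD.right n u v

theorem commutatorFormula_translate_left (h : CommutatorFormula ε mode u v w) :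
    CommutatorFormula ε mode (D u) v w := by
  have hF : iterateModes mode (D u) v w = -negDerivFst R (iterateModes mode u v w) := by
    ext i j
    simp [iterateModes, hD.left]
  rw [CommutatorFormula, hF, map_neg, expandDiff_negDerivFst, ← h]
  ext m n
  simp only [modeCommutator, hD.left, map_neg, map_nsmul, smul_neg, smul_sub, smul_comm ε,
    Pi.neg_apply, Pi.smul_apply, negDeriv_apply]
  abel

theorem commutatorFormula_translate_mid (h : CommutatorFormula ε mode u v w) :
    CommutatorFormula ε mode u (D v) w := by
  have hF : iterateModes mode u (D v) w =
      negDerivFst R (iterateModes mode u v w) - negDerivSnd R (iterateModes mode u v w) := by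
    ext i j
    simp only [iterateModes, hD.left, hD.right, map_add, map_nsmul, LinearMap.add_apply,
      LinearMap.smul_apply, Pi.sub_apply, Pi.smul_apply, negDeriv_apply, LinearMap.compLeft_apply,
      Function.comp_apply]
    abel
  rw [CommutatorFormula, hF, map_sub, expandDiff_negDerivFst, expandDiff_negDerivSnd,
    sub_add_cancel_left, ← h]
  ext m n
  simp only [modeCommutator, hD.left, map_neg, map_nsmul, smul_neg, smul_sub, smul_comm ε,
    Pi.neg_apply, negDeriv_apply, LinearMap.compLeft_apply, Function.comp_apply]
  abel

theorem commutatorFormula_translate_right (h : CommutatorFormula ε mode u v w) :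
    CommutatorFormula ε mode u v (D w) := by
  have hF : iterateModes mode u v (D w) =
      (D.compLeft ℕ).compLeft ℕ (iterateModes mode u v w) +
        negDerivSnd R (iterateModes mode u v w) := by
    ext i j
    simp [iterateModes, hD.right]
  rw [CommutatorFormula, hF, map_add, expandDiff_compLeft, expandDiff_negDerivSnd, ← h]
  ext m n
  simp only [modeCommutator, hD.right, map_add, map_sub, map_smul, map_nsmul, smul_add, smul_sub,
    smul_comm ε, Pi.add_apply, Pi.smul_apply, negDeriv_apply, LinearMap.compLeft_apply,
    Function.comp_apply]
  abel

end IsTranslationCovariant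

end TranslationCovariant

section SkewSymmetry

open Filter

variable {K U : Type*} [Field K] [AddCommGroup U] [Module K U]

/-- The skew symmetry `Y⁻(u, x) v ≃ ε e^(x D) Y⁻(v, -x) u`, for the sign `ε` of the transposition of
`u` and `v`. -/
def SkewSymmetry (ε : K) (mode : ℕ → U →ₗ[K] U →ₗ[K] U) (D : U →ₗ[K] U) (u v : U) : Prop :=
  (fun n => mode n u v) = ε • skewTransform D fun n => mode n v u

variable {mode : ℕ → U →ₗ[K] U →ₗ[K] U} {D : U →ₗ[K] U} {ε : K} {u v u' v' : U}

theorem SkewSymmetry.add_left (htrunc : ∀ u v, ∀ᶠ n in atTop, mode n u v = 0)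
    (h : SkewSymmetry ε mode D u v) (h' : SkewSymmetry ε mode D u' v) :
    SkewSymmetry ε mode D (u + u') v := by
  have hadd : (fun n => mode n v (u + u')) = (fun n => mode n v u) + fun n => mode n v u' := by
    ext n
    simp
  rw [SkewSymmetry, hadd, skewTransform_add D (htrunc v u) (htrunc v u'), smul_add, ← h, ← h']
  ext n
  simp

theorem SkewSymmetry.add_right (htrunc : ∀ u v, ∀ᶠ n in atTop, mode n u v = 0)
    (h : SkewSymmetry ε mode D u v) (h' : SkewSymmetry ε mode D u v') :
    SkewSymmetry ε mode D u (v + v') := by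
  have hadd : (fun n => mode n (v + v') u) = (fun n => mode n v u) + fun n => mode n v' u := by
    ext n
    simp
  rw [SkewSymmetry, hadd, skewTransform_add D (htrunc v u) (htrunc v' u), smul_add, ← h, ← h']
  ext n
  simp

variable [CharZero K]

theorem IsTranslationCovariant.skewSymmetry_translate_left (hD : IsTranslationCovariant mode D)
    (htrunc : ∀ᶠ n in atTop, mode n v u = 0) (h : SkewSymmetry ε mode D u v) :
    SkewSymmetry ε mode D (D u) v := by
  rw [SkewSymmetry, hD.translate_left_eq_negDeriv, hD.translate_right_eq_add_negDeriv,
    skewTransform_add, skewTransform_compLeft D htrunc, skewTransform_negDeriv D htrunc, h,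
    map_smul]
  · module
  · filter_upwards [htrunc] with n hn using by simp [hn]
  · filter_upwards [(tendsto_sub_atTop_nat 1).eventually htrunc] with n hn using by simp [hn]

theorem IsTranslationCovariant.skewSymmetry_translate_right (hD : IsTranslationCovariant mode D)
    (htrunc : ∀ᶠ n in atTop, mode n v u = 0) (h : SkewSymmetry ε mode D u v) :
    SkewSymmetry ε mode D u (D v) := by
  rw [SkewSymmetry, hD.translate_left_eq_negDeriv, hD.translate_right_eq_add_negDeriv,
    skewTransform_neg, skewTransform_negDeriv D htrunc, h, map_smul, map_smul]
  module

end SkewSymmetry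

/-! ### Coefficients of the half Jacobi identity -/

section Coefficients

variable {U : Type*} [AddCommGroup U] [Module ℂ U] (mode : ℕ → U →ₗ[ℂ] U →ₗ[ℂ] U) (u v w : U)

theorem exists_eq_neg_natCast_sub_one {e : ℤ} (he : e < 0) : ∃ n : ℕ, e = -(n : ℤ) - 1 :=
  ⟨(-e - 1).toNat, by omega⟩

theorem neg_one_pow_mul_choose_neg_sub_one_add (m i : ℕ) :
    (-1 : ℤ) ^ i * Ring.choose (-(m : ℤ) - 1 + i) i = m.choose i := by
  have h := Ring.choose_neg ((m : ℤ) + 1 - i) i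
  rw [show -((m : ℤ) + 1 - i) = -(m : ℤ) - 1 + i by ring,
    show (m : ℤ) + 1 - i + i - 1 = m by ring, Ring.choose_natCast] at h
  rw [h, Units.smul_def, smul_eq_mul, ← mul_assoc, Int.negOnePow_def, zpow_natCast,
    Units.val_pow_eq_pow_val, Units.val_neg, Units.val_one, ← mul_pow, neg_one_mul, neg_neg,
    one_pow, one_mul]

theorem Yminus_neg_sub_one (n : ℕ) : Yminus mode u v (-(n : ℤ) - 1) = mode n u v := by
  rw [Yminus, if_pos (by omega), show (-(-(n : ℤ) - 1) - 1).toNat = n by omega]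

theorem Yminus_neg_sub_one_sub (n k : ℕ) :
    Yminus mode u v (-(n : ℤ) - 1 - k) = mode (n + k) u v := by
  rw [← Yminus_neg_sub_one]
  congr 1
  push_cast
  ring

theorem Yminus_of_nonneg {e : ℤ} (he : 0 ≤ e) : Yminus mode u v e = 0 :=
  if_neg he.not_gt

theorem jacobiIterate_eq_mulAdd_pow (l m n : ℕ) :
    jacobiIterate mode u v w (-(l : ℤ) - 1) (-(m : ℤ) - 1) (-(n : ℤ) - 1) =
      (mulAdd ℂ ^ m) (iterateModes mode u v w) l n := by
  simp only [jacobiIterate, neg_one_pow_mul_choose_neg_sub_one_add]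
  rw [mulAdd_pow_apply, finsum_eq_sum_of_support_subset (s := Finset.range (m + 1))]
  · refine Finset.sum_congr rfl fun i hi => ?_
    have hi := Finset.mem_range.1 hi
    rw [show -(n : ℤ) - 1 + (-(m : ℤ) - 1 + i) + 1 = -((n + (m - i) : ℕ) : ℤ) - 1 by omega,
      Yminus_neg_sub_one, Yminus_neg_sub_one_sub, natCast_zsmul, iterateModes]
  · intro i hi
    by_contra h
    refine hi ?_
    beta_reduce
    rw [Nat.choose_eq_zero_of_lt (by simpa using h), Nat.cast_zero, zero_smul]

theorem finsum_choose_smul_Yminus_eq_mulSub_pow (l m n : ℕ) :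
    ∑ᶠ i : ℕ, ((-1 : ℤ) ^ i * Ring.choose (-(-(l : ℤ) - 1) - 1) i) •
      Yminus mode u (Yminus mode v w (-(n : ℤ) - 1 - i))
        (-(m : ℤ) - 1 - (-(-(l : ℤ) - 1) - 1) + i) =
      (mulSub ℂ ^ l) (fun i j => mode i u (mode j v w)) m n := by
  rw [show -(-(l : ℤ) - 1) - 1 = l by ring, mulSub_pow_apply]
  simp only [Ring.choose_natCast]
  rw [finsum_eq_sum_of_support_subset (s := Finset.range (l + 1))]
  · refine Finset.sum_congr rfl fun i hi => ?_
    have hi := Finset.mem_range.1 hi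
    rw [show -(m : ℤ) - 1 - l + i = -((m + (l - i) : ℕ) : ℤ) - 1 by omega,
      Yminus_neg_sub_one, Yminus_neg_sub_one_sub]
  · intro i hi
    by_contra h
    refine hi ?_
    beta_reduce
    rw [Nat.choose_eq_zero_of_lt (by simpa using h), Nat.cast_zero, mul_zero, zero_smul]

theorem jacobiProduct_eq_mulSub_pow (l m n : ℕ) :
    jacobiProduct mode u v w (-(l : ℤ) - 1) (-(m : ℤ) - 1) (-(n : ℤ) - 1) =
      (mulSub ℂ ^ l) (fun i j => mode i u (mode j v w)) m n :=
  finsum_choose_smul_Yminus_eq_mulSub_pow mode u v w l m n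

theorem jacobiOpposite_eq_mulSub_pow (l m n : ℕ) :
    jacobiOpposite mode u v w (-(l : ℤ) - 1) (-(m : ℤ) - 1) (-(n : ℤ) - 1) =
      (mulSub ℂ ^ l) (fun i j => mode j v (mode i u w)) m n := by
  rw [mulSub_pow_swap ℂ l fun i j => mode i v (mode j u w), jacobiOpposite,
    finsum_choose_smul_Yminus_eq_mulSub_pow, show -(-(l : ℤ) - 1) - 1 = l by ring,
    ← Int.cast_smul_eq_zsmul ℂ]
  push_cast
  rfl

end Coefficients

section Criterion

open Filter

variable {U : Type*} [AddCommGroup U] [Module ℂ U] {mode : ℕ → U →ₗ[ℂ] U →ₗ[ℂ] U}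
  {D : U →ₗ[ℂ] U} {u v w : U}

theorem IsTranslationCovariant.map_Yminus_sub (hD : IsTranslationCovariant mode D) (u v : U)
    (e : ℤ) : D (Yminus mode u v e) - Yminus mode u (D v) e = Yminus mode (D u) v e := by
  rcases lt_or_ge e 0 with he | he
  · obtain ⟨n, rfl⟩ := exists_eq_neg_natCast_sub_one he
    simp only [Yminus_neg_sub_one, hD.left, hD.right, sub_add_cancel_left]
  · simp only [Yminus_of_nonneg _ _ _ he, map_zero, sub_zero]

theorem IsTranslationCovariant.Yminus_translate_left (hD : IsTranslationCovariant mode D) (u v : U)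
    (e : ℤ) : Yminus mode (D u) v e = (e + 1) • Yminus mode u v (e + 1) := by
  rcases lt_or_ge e 0 with he | he
  · obtain ⟨n, rfl⟩ := exists_eq_neg_natCast_sub_one he
    rw [Yminus_neg_sub_one, hD.left]
    rcases n with _ | n
    · simp
    · rw [show -((n + 1 : ℕ) : ℤ) - 1 + 1 = -(n : ℤ) - 1 by push_cast; ring, Yminus_neg_sub_one,
        Nat.add_sub_cancel, ← natCast_zsmul, ← neg_smul]
      congr 1
      push_cast
      ring
  · rw [Yminus_of_nonneg _ _ _ he, Yminus_of_nonneg _ _ _ (he.trans (by omega)), smul_zero]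

theorem SkewSymmetry.Yminus_eq {ε : ℂ} (h : SkewSymmetry ε mode D u v) {e : ℤ} (he : e < 0) :
    Yminus mode u v e = ε • ∑ᶠ k : ℕ, ((k.factorial : ℂ)⁻¹) •
      (D ^ k) ((-1 : ℂ) ^ (e - k) • Yminus mode v u (e - k)) := by
  obtain ⟨n, rfl⟩ := exists_eq_neg_natCast_sub_one he
  rw [Yminus_neg_sub_one, congr_fun h n, Pi.smul_apply, skewTransform]
  congr 1
  refine finsum_congr fun k => ?_
  have hsign : (-1 : ℂ) ^ (-(n : ℤ) - 1 - k) = (-1) ^ (n + k + 1) := by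
    rw [← zpow_natCast]
    exact neg_one_zpow_congr ⟨-(n + k + 1), by push_cast; ring⟩
  rw [Yminus_neg_sub_one_sub, map_smul, hsign, smul_smul, div_eq_inv_mul]

theorem CommutatorFormula.jacobi {ε : ℂ} (h : CommutatorFormula ε mode u v w) {e₀ e₁ e₂ : ℤ}
    (h₀ : e₀ < 0) (h₁ : e₁ < 0) (h₂ : e₂ < 0) :
    jacobiIterate mode u v w e₀ e₁ e₂ =
      jacobiProduct mode u v w e₀ e₁ e₂ - ε • jacobiOpposite mode u v w e₀ e₁ e₂ := by
  obtain ⟨l, rfl⟩ := exists_eq_neg_natCast_sub_one h₀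
  obtain ⟨m, rfl⟩ := exists_eq_neg_natCast_sub_one h₁
  obtain ⟨n, rfl⟩ := exists_eq_neg_natCast_sub_one h₂
  rw [jacobiIterate_eq_mulAdd_pow, jacobiProduct_eq_mulSub_pow, jacobiOpposite_eq_mulSub_pow,
    mulAdd_pow_apply_eq, ← h]
  have hsub : modeCommutator ε mode u v w = (fun i j => mode i u (mode j v w)) -
      ε • fun i j => mode j v (mode i u w) := rfl
  rw [hsub, map_sub, map_smul]
  rfl

theorem isDGVertexLieAlgebra_of_commutatorFormula {N : ℤ} {𝒰 : ℤ → Submodule ℂ U}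
    {d : U →ₗ[ℂ] U} (hU : IsCochainComplex 𝒰 d)
    (mode_mem : ∀ (n : ℕ) p q u v, u ∈ 𝒰 p → v ∈ 𝒰 q → mode n u v ∈ 𝒰 (p + q - 2 * N * (n + 1)))
    (d_mode : ∀ n p u v, u ∈ 𝒰 p →
      d (mode n u v) = mode n (d u) v + (-1 : ℂ) ^ p • mode n u (d v))
    (D_mem : ∀ p u, u ∈ 𝒰 p → D u ∈ 𝒰 (p + 2 * N)) (D_d : ∀ u, D (d u) = d (D u))
    (truncation : ∀ u v, ∀ᶠ n in atTop, mode n u v = 0) (hD : IsTranslationCovariant mode D)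
    (skew : ∀ p q u v, u ∈ 𝒰 p → v ∈ 𝒰 q → SkewSymmetry ((-1 : ℂ) ^ (p * q)) mode D u v)
    (commutator : ∀ p q u v w, u ∈ 𝒰 p → v ∈ 𝒰 q →
      CommutatorFormula ((-1 : ℂ) ^ (p * q)) mode u v w) :
    IsDGVertexLieAlgebra N 𝒰 d mode D where
  toIsCochainComplex := hU
  mode_mem := mode_mem
  d_mode n p u v hu := by
    rw [d_mode n p u v hu, show p - 2 * N * ((n : ℤ) + 1) = p + 2 * (-(N * (n + 1))) by ring,
      neg_one_zpow_add_two_mul]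
  D_mem := D_mem
  D_d := D_d
  truncation u v := eventually_atTop.1 (truncation u v)
  D_comm := hD.map_Yminus_sub
  D_deriv := hD.Yminus_translate_left
  half_skew p q u v hu hv _ he := (skew p q u v hu hv).Yminus_eq he
  half_jacobi p q u v w hu hv _ _ _ h₀ h₁ h₂ := (commutator p q u v w hu hv).jacobi h₀ h₁ h₂

end Criterion

/-! ### Lie brackets of even degree -/

section EvenBracket

variable {g : Type*} [AddCommGroup g] [Module ℂ g] {N : ℤ} {𝒢 : ℤ → Submodule ℂ g}
  {d : g →ₗ[ℂ] g} {br : g →ₗ[ℂ] g →ₗ[ℂ] g} {form : g →ₗ[ℂ] g →ₗ[ℂ] ℂ} {p q : ℤ} {a b : g}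

theorem IsDGLieAlgebra.d_br_even (hg : IsDGLieAlgebra (-2 * N) 𝒢 d br) (ha : a ∈ 𝒢 p) (b : g) :
    d (br a b) = br (d a) b + (-1 : ℂ) ^ p • br a (d b) := by
  rw [hg.d_br p a b ha, show p + -2 * N = p + 2 * -N by ring, neg_one_zpow_add_two_mul]

theorem IsDGLieAlgebra.antisymm_even (hg : IsDGLieAlgebra (-2 * N) 𝒢 d br) (ha : a ∈ 𝒢 p)
    (hb : b ∈ 𝒢 q) : br a b = -((-1 : ℂ) ^ (p * q) • br b a) := by
  rw [hg.antisymm p q a b ha hb, show -2 * N = 2 * -N by ring,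
    neg_one_zpow_add_two_mul_mul_add_two_mul]

theorem IsDGLieAlgebra.jacobi_even (hg : IsDGLieAlgebra (-2 * N) 𝒢 d br) (ha : a ∈ 𝒢 p)
    (hb : b ∈ 𝒢 q) (c : g) :
    br a (br b c) = br (br a b) c + (-1 : ℂ) ^ (p * q) • br b (br a c) := by
  rw [hg.jacobi p q a b c ha hb, show -2 * N = 2 * -N by ring,
    neg_one_zpow_add_two_mul_mul_add_two_mul]

theorem IsInvariantForm.d_form_even (hform : IsInvariantForm (-2 * N) 𝒢 d br form)
    (ha : a ∈ 𝒢 p) (b : g) : form (d a) b + (-1 : ℂ) ^ p * form a (d b) = 0 := by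
  have h := hform.d_form p a b ha
  rwa [neg_one_zpow_add_two_mul] at h

theorem IsInvariantForm.form_eq_zero (hform : IsInvariantForm (-2 * N) 𝒢 d br form)
    (ha : a ∈ 𝒢 p) (hb : b ∈ 𝒢 q) (h : p + q ≠ 4 * N) : form a b = 0 :=
  hform.degree p q a b ha hb (by omega)

theorem IsInvariantForm.symm_even (hform : IsInvariantForm (-2 * N) 𝒢 d br form)
    (ha : a ∈ 𝒢 p) (hb : b ∈ 𝒢 q) : form a b = (-1 : ℂ) ^ (p * q) * form b a := by
  by_cases h : p + q = 4 * N
  · rw [hform.symm p q a b ha hb]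
    congr 1
    refine neg_one_zpow_congr ?_
    obtain rfl : q = 4 * N - p := by omega
    rw [show p + 2 * (-2 * N) - p * (4 * N - p) = p * (p + 1) + 2 * (-2 * N - 2 * N * p) by ring]
    exact (Int.even_mul_succ_self p).add (even_two_mul _)
  · rw [hform.form_eq_zero ha hb h, hform.form_eq_zero hb ha (by omega), mul_zero]

theorem IsInvariantForm.form_br_swap (hg : IsDGLieAlgebra (-2 * N) 𝒢 d br)
    (hform : IsInvariantForm (-2 * N) 𝒢 d br form) (ha : a ∈ 𝒢 p) (hb : b ∈ 𝒢 q) (c : g) :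
    (-1 : ℂ) ^ (p * q) * form b (br a c) = -form (br a b) c := by
  simp [hg.antisymm_even ha hb, ← hform.invariant]

end EvenBracket

/-! ### The complex `ℂ[D] ⊗ g ⊕ ℂK` -/

section CurrentComplex

variable {g : Type*} [AddCommGroup g] [Module ℂ g] {N : ℤ} {𝒢 : ℤ → Submodule ℂ g}
  {d : g →ₗ[ℂ] g}

theorem currentD_currentOf (k : ℕ) (a : g) : currentD (currentOf k a) = currentOf (k + 1) a := by
  simp [currentD, currentOf]

theorem currentD_currentK : currentD (currentK : Current g) = 0 := by
  simp [currentD, currentK]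

theorem currentDiff_currentOf (k : ℕ) (a : g) :
    currentDiff d (currentOf k a) = currentOf k (d a) := by
  simp [currentDiff, currentOf]

theorem currentDiff_currentK : currentDiff d (currentK : Current g) = 0 := by
  simp [currentDiff, currentK]

theorem Current.eq_sum_currentOf_add_smul_currentK (u : Current g) :
    u = ∑ k ∈ u.1.support, currentOf k (u.1 k) + u.2 • currentK := by
  have hsum : ∑ k ∈ u.1.support, currentOf k (u.1 k) = LinearMap.inl ℂ (ℕ →₀ g) ℂ u.1 := by
    conv_rhs => rw [← Finsupp.sum_single u.1]
    exact (map_sum (LinearMap.inl ℂ (ℕ →₀ g) ℂ) _ _).symm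
  rw [hsum]
  simp [currentK]

theorem Current.induction_currentOf {P : Current g → Prop} (central : ∀ c : ℂ, P (c • currentK))
    (monomial : ∀ k a, P (currentOf k a)) (add : ∀ u v, P u → P v → P (u + v)) (u : Current g) :
    P u := by
  rw [Current.eq_sum_currentOf_add_smul_currentK u]
  refine add _ _ (Finset.sum_induction _ P add ?_ fun k _ => monomial k _) (central _)
  simpa using central 0

theorem Current.induction_currentD {P : Current g → Prop} (central : ∀ c : ℂ, P (c • currentK))
    (generator : ∀ a, P (currentOf 0 a)) (translate : ∀ u, P u → P (currentD u))
    (add : ∀ u v, P u → P v → P (u + v)) (u : Current g) : P u := by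
  refine Current.induction_currentOf central (fun k a => ?_) add u
  induction k with
  | zero => exact generator a
  | succ k ih => exact currentD_currentOf k a ▸ translate _ ih

theorem currentOf_mem {p : ℤ} {k : ℕ} {a : g} (ha : a ∈ 𝒢 (p - 2 * N * k)) :
    currentOf k a ∈ currentDeg N 𝒢 p := by
  refine ⟨fun j => ?_, by simp [currentOf]⟩
  simp only [currentOf, LinearMap.comp_apply, LinearMap.inl_apply, Finsupp.lsingle_apply,
    Finsupp.single_apply]
  split_ifs with h
  · exact h ▸ ha
  · exact zero_mem _

theorem smul_currentK_mem {p : ℤ} {c : ℂ} (h : p = 0 ∨ c = 0) :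
    c • (currentK : Current g) ∈ currentDeg N 𝒢 p := by
  rcases h with rfl | rfl
  · exact ⟨fun j => by simp [currentK], by simp⟩
  · simp

theorem currentDeg_induction {P : ℤ → Current g → Prop}
    (central : ∀ p (c : ℂ), P p (c • currentK)) (generator : ∀ p, ∀ a ∈ 𝒢 p, P p (currentOf 0 a))
    (translate : ∀ p u, P p u → P (p + 2 * N) (currentD u))
    (add : ∀ p u v, P p u → P p v → P p (u + v)) {p : ℤ} {u : Current g}
    (hu : u ∈ currentDeg N 𝒢 p) : P p u := by
  have monomial (k : ℕ) : ∀ (p : ℤ) (a : g), a ∈ 𝒢 (p - 2 * N * k) → P p (currentOf k a) := by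
    induction k with
    | zero => exact fun p a ha => generator p a (by simpa using ha)
    | succ k ih =>
      intro p a ha
      have h := translate _ _ (ih (p - 2 * N) a (by convert ha using 2; push_cast; ring))
      rwa [currentD_currentOf, sub_add_cancel] at h
  rw [Current.eq_sum_currentOf_add_smul_currentK u]
  refine add _ _ _ (Finset.sum_induction _ (P p) (add p) ?_ fun k _ => ?_) (central p _)
  · simpa using central p 0
  · exact monomial k p _ (hu.1 k)

theorem currentDeg_induction₂ {P : ℤ → ℤ → Current g → Current g → Prop}
    (central_left : ∀ p q (c : ℂ) v, P p q (c • currentK) v)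
    (central_right : ∀ p q u (c : ℂ), P p q u (c • currentK))
    (generators : ∀ p q, ∀ a ∈ 𝒢 p, ∀ b ∈ 𝒢 q, P p q (currentOf 0 a) (currentOf 0 b))
    (translate_left : ∀ p q u v, P p q u v → P (p + 2 * N) q (currentD u) v)
    (translate_right : ∀ p q u v, P p q u v → P p (q + 2 * N) u (currentD v))
    (add_left : ∀ p q u u' v, P p q u v → P p q u' v → P p q (u + u') v)
    (add_right : ∀ p q u v v', P p q u v → P p q u v' → P p q u (v + v'))
    {p q : ℤ} {u v : Current g} (hu : u ∈ currentDeg N 𝒢 p) (hv : v ∈ currentDeg N 𝒢 q) :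
    P p q u v := by
  refine currentDeg_induction (P := fun p u => P p q u v) (fun p c => central_left p q c v)
    (fun p a ha => ?_) (fun p u => translate_left p q u v)
    (fun p u u' => add_left p q u u' v) hu
  exact currentDeg_induction (P := fun q v => P p q (currentOf 0 a) v)
    (fun q c => central_right p q _ c) (fun q b hb => generators p q a ha b hb)
    (fun q v => translate_right p q _ v) (fun q v v' => add_right p q _ v v') hv

theorem currentDeg_isCochainComplex (hg : IsCochainComplex 𝒢 d) :
    IsCochainComplex (currentDeg N 𝒢) (currentDiff d) where
  isInternal := isInternal_prod
    (isInternal_finsupp fun k : ℕ =>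
      isInternal_comp_equiv hg.isInternal (Equiv.subRight (2 * N * k)))
    (isInternal_concentrated 0)
  d_mem p v hv := by
    refine ⟨fun k => ?_, by simp [currentDiff]⟩
    have h := hg.d_mem _ _ (hv.1 k)
    rw [sub_add_eq_add_sub] at h
    simpa [currentDiff] using h
  d_d v := by
    ext
    · simp [currentDiff, hg.d_d]
    · simp [currentDiff]

theorem currentD_mem {p : ℤ} {u : Current g} (hu : u ∈ currentDeg N 𝒢 p) :
    currentD u ∈ currentDeg N 𝒢 (p + 2 * N) := by
  refine ⟨fun k => ?_, by simp [currentD]⟩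
  change Finsupp.mapDomain (fun k => k + 1) u.1 k ∈ _
  rcases k with _ | k
  · rw [Finsupp.mapDomain_of_notMem_range _ _ (by simp)]
    exact zero_mem _
  · rw [Finsupp.mapDomain_apply (add_left_injective 1)]
    have h := hu.1 k
    rwa [show p - 2 * N * k = p + 2 * N - 2 * N * (k + 1 : ℕ) by push_cast; ring] at h

theorem currentD_currentDiff (u : Current g) :
    currentD (currentDiff d u) = currentDiff d (currentD u) := by
  induction u using Current.induction_currentOf with
  | central c => simp [currentDiff_currentK, currentD_currentK]
  | add u v hu hv => simp only [map_add, hu, hv]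
  | monomial k a => simp only [currentD_currentOf, currentDiff_currentOf]

end CurrentComplex

/-! ### The dg vertex Lie algebra `ℂ[D] ⊗ g ⊕ ℂK` -/

section CurrentMode

open Filter

variable {g : Type*} [AddCommGroup g] [Module ℂ g] {N : ℤ} {𝒢 : ℤ → Submodule ℂ g}
  {d : g →ₗ[ℂ] g} {br : g →ₗ[ℂ] g →ₗ[ℂ] g} {form : g →ₗ[ℂ] g →ₗ[ℂ] ℂ}

theorem generatorMode_zero (a b : g) : generatorMode br form 0 a b = currentOf 0 (br a b) := rfl

theorem generatorMode_one (a b : g) : generatorMode br form 1 a b = form a b • currentK := by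
  simp [generatorMode, currentK]

theorem generatorMode_add_two (n : ℕ) (a b : g) : generatorMode br form (n + 2) a b = 0 := rfl

theorem currentMode_currentOf (k l : ℕ) (a b : g) :
    (fun n => currentMode br form n (currentOf k a) (currentOf l b)) =
      ((-negDeriv ℂ) ^ k * (negDeriv ℂ + currentD.compLeft ℕ) ^ l : Module.End ℂ (ℕ → Current g))
        fun n => generatorMode br form n a b := by
  have hcoeff (m : ℕ) {i : ℕ} (hi : i ≤ l) :
      (l.factorial : ℂ) * (m.choose i * ((l - i).factorial : ℂ)⁻¹) =
        l.choose i * m.descFactorial i := by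
    rw [Nat.cast_choose ℂ hi, Nat.descFactorial_eq_factorial_mul_choose, Nat.cast_mul]
    have hi' : (i.factorial : ℂ) ≠ 0 := Nat.cast_ne_zero.2 i.factorial_ne_zero
    field_simp
  have hneg : ((-negDeriv ℂ) ^ k : Module.End ℂ (ℕ → Current g)) =
      (-1 : ℂ) ^ k • negDeriv ℂ ^ k := by
    rw [← smul_pow, neg_one_smul]
  ext1 n
  rw [hneg, smul_mul_assoc, LinearMap.smul_apply, Pi.smul_apply, Module.End.mul_apply,
    negDeriv_pow_apply, negDeriv_add_compLeft_pow_apply,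
    Nat.descFactorial_eq_factorial_mul_choose]
  simp only [currentMode, currentOf, LinearMap.compl₁₂_apply, LinearMap.fst_apply,
    LinearMap.comp_apply, LinearMap.inl_apply, Finsupp.lsingle_apply, finsuppBilin_single,
    LinearMap.smul_apply, LinearMap.sum_apply, LinearMap.compr₂_apply]
  simp only [← Nat.cast_smul_eq_nsmul ℂ, Finset.smul_sum, smul_smul, Nat.cast_mul]
  refine Finset.sum_congr rfl fun i hi => ?_
  rw [← hcoeff (n - k) (Finset.mem_range_succ_iff.1 hi)]
  congr 1
  ring

theorem isTranslationCovariant_currentMode :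
    IsTranslationCovariant (currentMode br form) currentD where
  left n u v := by
    induction u using Current.induction_currentOf with
    | central c => simp [currentMode_K_left, currentD_currentK]
    | add u u' hu hu' => simp only [map_add, LinearMap.add_apply, hu, hu', smul_add, neg_add]
    | monomial k a =>
      induction v using Current.induction_currentOf with
      | central c => simp [currentMode_K_right]
      | add v v' hv hv' => simp only [map_add, hv, hv', smul_add, neg_add]
      | monomial l b =>
        rw [currentD_currentOf]
        refine (congr_fun (currentMode_currentOf (k + 1) l a b) n).trans ?_
        rw [pow_succ', mul_assoc, Module.End.mul_apply, ← currentMode_currentOf]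
        rfl
  right n u v := by
    induction u using Current.induction_currentOf with
    | central c => simp [currentMode_K_left]
    | add u u' hu hu' =>
      simp only [map_add, LinearMap.add_apply, hu, hu', smul_add]
      abel
    | monomial k a =>
      induction v using Current.induction_currentOf with
      | central c => simp [currentMode_K_right, currentD_currentK]
      | add v v' hv hv' =>
        simp only [map_add, hv, hv', smul_add]
        abel
      | monomial l b =>
        have hcomm : Commute (-negDeriv ℂ : Module.End ℂ (ℕ → Current g))
            (negDeriv ℂ + currentD.compLeft ℕ) :=
          ((Commute.refl _).add_right
            (commute_negDeriv_compLeft ℂ (M := Current g) currentD)).neg_left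
        rw [currentD_currentOf]
        refine (congr_fun (currentMode_currentOf k (l + 1) a b) n).trans ?_
        rw [pow_succ', ← mul_assoc, (hcomm.pow_left k).eq, mul_assoc, Module.End.mul_apply,
          ← currentMode_currentOf]
        exact add_comm _ _

theorem currentMode_truncation (u v : Current g) :
    ∀ᶠ n in atTop, currentMode br form n u v = 0 := by
  have hD := isTranslationCovariant_currentMode (br := br) (form := form)
  induction u using Current.induction_currentD with
  | central c => simp [currentMode_K_left]
  | add u u' hu hu' => filter_upwards [hu, hu'] with n hn hn' using by simp [hn, hn']
  | translate u hu =>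
    filter_upwards [(tendsto_sub_atTop_nat 1).eventually hu] with n hn using by simp [hD.left, hn]
  | generator a =>
    induction v using Current.induction_currentD with
    | central c => simp [currentMode_K_right]
    | add v v' hv hv' => filter_upwards [hv, hv'] with n hn hn' using by simp [hn, hn']
    | translate v hv =>
      filter_upwards [hv, (tendsto_sub_atTop_nat 1).eventually hv] with n hn hn' using by
        simp [hD.right, hn, hn']
    | generator b =>
      filter_upwards [eventually_ge_atTop 2] with n hn
      obtain ⟨n, rfl⟩ := Nat.exists_eq_add_of_le' hn
      rw [currentMode_generators, generatorMode_add_two]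

theorem generatorMode_mem (hg : IsDGLieAlgebra (-2 * N) 𝒢 d br)
    (hform : IsInvariantForm (-2 * N) 𝒢 d br form) {p q : ℤ} {a b : g} (ha : a ∈ 𝒢 p)
    (hb : b ∈ 𝒢 q) (n : ℕ) :
    generatorMode br form n a b ∈ currentDeg N 𝒢 (p + q - 2 * N * (n + 1)) := by
  match n with
  | 0 =>
    refine currentOf_mem ?_
    convert hg.br_mem p q a b ha hb using 2
    push_cast
    ring
  | 1 =>
    rw [generatorMode_one]
    refine smul_currentK_mem ?_
    by_cases h : p + q = 4 * N
    · left
      push_cast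
      linear_combination h
    · exact Or.inr (hform.form_eq_zero ha hb h)
  | n + 2 => exact zero_mem _

theorem currentMode_mem (hg : IsDGLieAlgebra (-2 * N) 𝒢 d br)
    (hform : IsInvariantForm (-2 * N) 𝒢 d br form) (n : ℕ) {p q : ℤ} {u v : Current g}
    (hu : u ∈ currentDeg N 𝒢 p) (hv : v ∈ currentDeg N 𝒢 q) :
    currentMode br form n u v ∈ currentDeg N 𝒢 (p + q - 2 * N * (n + 1)) := by
  have hD := isTranslationCovariant_currentMode (br := br) (form := form)
  have smul_pred_mem {r : ℤ} {w : ℕ → Current g}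
      (hw : ∀ n : ℕ, w n ∈ currentDeg N 𝒢 (r - 2 * N * (n + 1))) (n : ℕ) :
      n • w (n - 1) ∈ currentDeg N 𝒢 (r + 2 * N - 2 * N * (n + 1)) := by
    rcases n with _ | n
    · simp
    · refine nsmul_mem ?_ _
      rw [Nat.add_sub_cancel]
      convert hw n using 2
      push_cast
      ring
  refine currentDeg_induction₂ (P := fun p q u v => ∀ n : ℕ,
    currentMode br form n u v ∈ currentDeg N 𝒢 (p + q - 2 * N * (n + 1)))
    ?_ ?_ ?_ ?_ ?_ ?_ ?_ hu hv n
  · intro p q c v n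
    simp [currentMode_K_left]
  · intro p q u c n
    simp [currentMode_K_right]
  · intro p q a ha b hb n
    exact currentMode_generators br form n a b ▸ generatorMode_mem hg hform ha hb n
  · intro p q u v h n
    rw [hD.left, add_right_comm]
    exact neg_mem (smul_pred_mem h n)
  · intro p q u v h n
    rw [hD.right, ← add_assoc]
    refine add_mem ?_ (smul_pred_mem h n)
    rw [add_sub_right_comm]
    exact currentD_mem (h n)
  · intro p q u u' v h h' n
    rw [map_add, LinearMap.add_apply]
    exact add_mem (h n) (h' n)
  · intro p q u v v' h h' n
    rw [map_add]
    exact add_mem (h n) (h' n)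

theorem currentDiff_generatorMode (hg : IsDGLieAlgebra (-2 * N) 𝒢 d br)
    (hform : IsInvariantForm (-2 * N) 𝒢 d br form) {p : ℤ} {a : g} (ha : a ∈ 𝒢 p) (n : ℕ) (b : g) :
    currentDiff d (generatorMode br form n a b) =
      generatorMode br form n (d a) b + (-1 : ℂ) ^ p • generatorMode br form n a (d b) := by
  match n with
  | 0 =>
    simp only [generatorMode_zero, currentDiff_currentOf, hg.d_br_even ha, map_add, map_smul]
  | 1 =>
    simp only [generatorMode_one, map_smul, currentDiff_currentK, smul_zero, smul_smul]
    rw [← add_smul, hform.d_form_even ha, zero_smul]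
  | n + 2 => simp [generatorMode_add_two]

theorem currentDiff_currentMode (hg : IsDGLieAlgebra (-2 * N) 𝒢 d br)
    (hform : IsInvariantForm (-2 * N) 𝒢 d br form) {p : ℤ} {u : Current g}
    (hu : u ∈ currentDeg N 𝒢 p) (n : ℕ) (v : Current g) :
    currentDiff d (currentMode br form n u v) = currentMode br form n (currentDiff d u) v +
      (-1 : ℂ) ^ p • currentMode br form n u (currentDiff d v) := by
  have hD := isTranslationCovariant_currentMode (br := br) (form := form)
  refine currentDeg_induction (P := fun p u => ∀ (n : ℕ) (v : Current g),
    currentDiff d (currentMode br form n u v) = currentMode br form n (currentDiff d u) v +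
      (-1 : ℂ) ^ p • currentMode br form n u (currentDiff d v)) ?_ ?_ ?_ ?_ hu n v
  · intro p c n v
    simp [currentMode_K_left, currentDiff_currentK]
  · intro p a ha n v
    induction v using Current.induction_currentD generalizing n with
    | central c => simp [currentMode_K_right, currentDiff_currentK]
    | add v v' hv hv' =>
      simp only [map_add, hv, hv', smul_add]
      abel
    | translate v hv =>
      simp only [← currentD_currentDiff, hD.right, map_add, map_smul, map_nsmul, hv, smul_add,
        smul_comm n]
      abel
    | generator b =>
      simpa only [currentDiff_currentOf, currentMode_generators] using
        currentDiff_generatorMode hg hform ha n b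
  · intro p u ih n v
    simp only [← currentD_currentDiff, hD.left, map_neg, map_nsmul, ih,
      neg_one_zpow_add_two_mul, smul_add, smul_neg, neg_add, smul_comm n]
  · intro p u u' h h' n v
    simp only [map_add, LinearMap.add_apply, h, h', smul_add]
    abel

theorem generatorMode_skew (hg : IsDGLieAlgebra (-2 * N) 𝒢 d br)
    (hform : IsInvariantForm (-2 * N) 𝒢 d br form) {p q : ℤ} {a b : g} (ha : a ∈ 𝒢 p)
    (hb : b ∈ 𝒢 q) (n : ℕ) :
    generatorMode br form n a b =
      (-1 : ℂ) ^ (p * q) • (-1 : ℂ) ^ (n + 1) • generatorMode br form n b a := by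
  match n with
  | 0 => simp [generatorMode_zero, hg.antisymm_even ha hb]
  | 1 => simp [generatorMode_one, hform.symm_even ha hb, smul_smul]
  | n + 2 => simp [generatorMode_add_two]

theorem skewTransform_generatorMode (a b : g) (n : ℕ) :
    skewTransform currentD (fun n => generatorMode br form n a b) n =
      (-1 : ℂ) ^ (n + 1) • generatorMode br form n a b := by
  have htrunc : ∀ n, 2 ≤ n → generatorMode br form n a b = 0 := fun n hn => by
    obtain ⟨n, rfl⟩ := Nat.exists_eq_add_of_le' hn
    exact generatorMode_add_two n a b
  have hD_one : currentD (generatorMode br form (n + 1) a b) = 0 := by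
    rcases n with _ | n
    · simp [generatorMode_one, currentD_currentK]
    · simp [generatorMode_add_two]
  rw [skewTransform_apply_eq_sum currentD htrunc]
  simp [Finset.sum_range_succ, hD_one]

theorem currentMode_skew (hg : IsDGLieAlgebra (-2 * N) 𝒢 d br)
    (hform : IsInvariantForm (-2 * N) 𝒢 d br form) {p q : ℤ} {u v : Current g}
    (hu : u ∈ currentDeg N 𝒢 p) (hv : v ∈ currentDeg N 𝒢 q) :
    SkewSymmetry ((-1 : ℂ) ^ (p * q)) (currentMode br form) currentD u v := by
  have hD := isTranslationCovariant_currentMode (br := br) (form := form)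
  refine currentDeg_induction₂ (P := fun p q u v =>
    SkewSymmetry ((-1 : ℂ) ^ (p * q)) (currentMode br form) currentD u v)
    ?_ ?_ ?_ ?_ ?_ (fun p q u u' v => .add_left currentMode_truncation)
    (fun p q u v v' => .add_right currentMode_truncation) hu hv
  · intro p q c v
    ext1 n
    simp [skewTransform, currentMode_K_left, currentMode_K_right]
  · intro p q u c
    ext1 n
    simp [skewTransform, currentMode_K_left, currentMode_K_right]
  · intro p q a ha b hb
    ext1 n
    simp only [currentMode_generators, Pi.smul_apply, skewTransform_generatorMode,
      generatorMode_skew hg hform ha hb n]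
  · intro p q u v h
    rw [neg_one_zpow_add_two_mul_mul]
    exact hD.skewSymmetry_translate_left (currentMode_truncation v u) h
  · intro p q u v h
    rw [neg_one_zpow_mul_add_two_mul]
    exact hD.skewSymmetry_translate_right (currentMode_truncation v u) h

theorem expandDiff_iterateModes_generators (a b : g) (w : Current g) (m n : ℕ) :
    expandDiff ℂ (iterateModes (currentMode br form) (currentOf 0 a) (currentOf 0 b) w) m n =
      currentMode br form (m + n) (currentOf 0 (br a b)) w := by
  have hsucc (i j : ℕ) : iterateModes (currentMode br form) (currentOf 0 a) (currentOf 0 b) w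
      (i + 1) j = 0 := by
    rw [iterateModes, currentMode_generators]
    rcases i with _ | i
    · simp [generatorMode_one, currentMode_K_left]
    · simp [generatorMode_add_two]
  simp only [expandDiff_apply_eq_sum, Finset.sum_range_succ', hsucc, smul_zero,
    Finset.sum_const_zero]
  simp [iterateModes, currentMode_generators, generatorMode_zero, add_comm]

theorem commutatorFormula_generators (hg : IsDGLieAlgebra (-2 * N) 𝒢 d br)
    (hform : IsInvariantForm (-2 * N) 𝒢 d br form) {p q : ℤ} {a b : g} (ha : a ∈ 𝒢 p)
    (hb : b ∈ 𝒢 q) (c : g) :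
    CommutatorFormula ((-1 : ℂ) ^ (p * q)) (currentMode br form) (currentOf 0 a) (currentOf 0 b)
      (currentOf 0 c) := by
  ext1 m
  ext1 n
  rw [expandDiff_iterateModes_generators, modeCommutator, sub_eq_iff_eq_add]
  simp only [currentMode_generators]
  match m, n with
  | 0, 0 =>
    simp only [generatorMode_zero, currentMode_generators, hg.jacobi_even ha hb c, map_add,
      map_smul, add_zero]
  | 1, 0 =>
    simp [generatorMode_zero, generatorMode_one, currentMode_generators, currentMode_K_right,
      hform.invariant]
  | 0, 1 =>
    simp only [generatorMode_zero, generatorMode_one, currentMode_generators,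
      currentMode_K_right, map_smul, smul_smul, hform.form_br_swap hg ha hb, zero_add]
    simp
  | m + 2, 0 => simp [generatorMode_zero, generatorMode_add_two, currentMode_generators]
  | 0, n + 2 => simp [generatorMode_zero, generatorMode_add_two, currentMode_generators]
  | 1, 1 => simp [generatorMode_one, generatorMode_add_two, currentMode_K_right]
  | 1, n + 2 =>
    rw [show 1 + (n + 2) = n + 1 + 2 by omega]
    simp [generatorMode_one, generatorMode_add_two, currentMode_K_right]
  | m + 2, 1 =>
    rw [show m + 2 + 1 = m + 1 + 2 by omega]
    simp [generatorMode_one, generatorMode_add_two, currentMode_K_right]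
  | m + 2, n + 2 =>
    rw [show m + 2 + (n + 2) = m + n + 2 + 2 by omega]
    simp [generatorMode_add_two]

theorem currentMode_commutator (hg : IsDGLieAlgebra (-2 * N) 𝒢 d br)
    (hform : IsInvariantForm (-2 * N) 𝒢 d br form) {p q : ℤ} {u v : Current g}
    (hu : u ∈ currentDeg N 𝒢 p) (hv : v ∈ currentDeg N 𝒢 q) (w : Current g) :
    CommutatorFormula ((-1 : ℂ) ^ (p * q)) (currentMode br form) u v w := by
  have hD := isTranslationCovariant_currentMode (br := br) (form := form)
  refine currentDeg_induction₂ (P := fun p q u v => ∀ w,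
    CommutatorFormula ((-1 : ℂ) ^ (p * q)) (currentMode br form) u v w)
    ?_ ?_ ?_ ?_ ?_ (fun p q u u' v h h' w => (h w).add_left (h' w))
    (fun p q u v v' h h' w => (h w).add_mid (h' w)) hu hv w
  · intro p q c v w
    ext m n
    all_goals simp [modeCommutator, expandDiff_apply_eq_sum, iterateModes, currentMode_K_left]
  · intro p q u c w
    ext m n
    all_goals simp [modeCommutator, expandDiff_apply_eq_sum, iterateModes, currentMode_K_left,
      currentMode_K_right]
  · intro p q a ha b hb w
    induction w using Current.induction_currentD with
    | central c =>
      ext m n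
      all_goals simp [modeCommutator, expandDiff_apply_eq_sum, iterateModes, currentMode_K_right]
    | generator c => exact commutatorFormula_generators hg hform ha hb c
    | translate w h => exact hD.commutatorFormula_translate_right h
    | add w w' h h' => exact h.add_right h'
  · intro p q u v h w
    rw [neg_one_zpow_add_two_mul_mul]
    exact hD.commutatorFormula_translate_left (h w)
  · intro p q u v h w
    rw [neg_one_zpow_mul_add_two_mul]
    exact hD.commutatorFormula_translate_mid (h w)

theorem isDGVertexLieAlgebra_current (hg : IsDGLieAlgebra (-2 * N) 𝒢 d br)
    (hform : IsInvariantForm (-2 * N) 𝒢 d br form) :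
    IsDGVertexLieAlgebra N (currentDeg N 𝒢) (currentDiff d) (currentMode br form) currentD :=
  isDGVertexLieAlgebra_of_commutatorFormula
    (currentDeg_isCochainComplex hg.toIsCochainComplex)
    (fun n _ _ _ _ => currentMode_mem hg hform n)
    (fun n _ _ v hu => currentDiff_currentMode hg hform hu n v) (fun _ _ => currentD_mem)
    currentD_currentDiff currentMode_truncation isTranslationCovariant_currentMode
    (fun _ _ _ _ => currentMode_skew hg hform)
    (fun _ _ _ _ w hu hv => currentMode_commutator hg hform hu hv w)

end CurrentMode

/-! ### The affine dg Lie algebra -/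

section Affine

variable {g : Type*} [AddCommGroup g] [Module ℂ g] {N : ℤ} {𝒢 : ℤ → Submodule ℂ g}
  {d : g →ₗ[ℂ] g} {br : g →ₗ[ℂ] g →ₗ[ℂ] g} {form : g →ₗ[ℂ] g →ₗ[ℂ] ℂ}

theorem Affine.eq_sum_affineOf_add_smul_affineK (x : Affine g) :
    x = ∑ n ∈ x.1.support, affineOf n (x.1 n) + x.2 • affineK := by
  have hsum : ∑ n ∈ x.1.support, affineOf n (x.1 n) = LinearMap.inl ℂ (ℤ →₀ g) ℂ x.1 := by
    conv_rhs => rw [← Finsupp.sum_single x.1]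
    exact (map_sum (LinearMap.inl ℂ (ℤ →₀ g) ℂ) _ _).symm
  rw [hsum]
  simp [affineK]

theorem Affine.induction_affineOf {P : Affine g → Prop} (central : ∀ c : ℂ, P (c • affineK))
    (monomial : ∀ n a, P (affineOf n a)) (add : ∀ x y, P x → P y → P (x + y)) (x : Affine g) :
    P x := by
  rw [Affine.eq_sum_affineOf_add_smul_affineK x]
  refine add _ _ (Finset.sum_induction _ P add ?_ fun n _ => monomial n _) (central _)
  simpa using central 0

theorem affineOf_add (n : ℤ) (a b : g) : affineOf n (a + b) = affineOf n a + affineOf n b := by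
  simp [affineOf]

theorem affineOf_smul (n : ℤ) (c : ℂ) (a : g) : affineOf n (c • a) = c • affineOf n a := by
  simp [affineOf]

theorem affineOf_neg (n : ℤ) (a : g) : affineOf n (-a) = -affineOf n a := by
  simp [affineOf]

theorem affineD_affineOf (n : ℤ) (a : g) : affineD d (affineOf n a) = affineOf n (d a) := by
  simp [affineD, affineOf, loopD]

theorem affineD_affineK : affineD d (affineK : Affine g) = 0 := by
  simp [affineD, affineK]

theorem affineBracket_affineK_left (x : Affine g) : affineBracket br form affineK x = 0 := by
  simp [affineBracket, affineK]

theorem affineBracket_affineK_right (x : Affine g) : affineBracket br form x affineK = 0 := by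
  simp [affineBracket, affineK]

theorem affineBracket_affineOf (m n : ℤ) (a b : g) :
    affineBracket br form (affineOf m a) (affineOf n b) =
      affineOf (m + n) (br a b) + ((if m + n = 0 then (m : ℂ) else 0) * form a b) • affineK := by
  by_cases h : m + n = 0 <;> simp [affineBracket, affineOf, affineK, h]

theorem affineOf_mem {p n : ℤ} {a : g} (ha : a ∈ 𝒢 (p + 2 * N * n)) :
    affineOf n a ∈ affineDeg N 𝒢 p := by
  refine ⟨fun j => ?_, by simp [affineOf]⟩
  simp only [affineOf, Finsupp.single_apply]
  split_ifs with h
  · exact h ▸ ha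
  · exact zero_mem _

theorem smul_affineK_mem {p : ℤ} {c : ℂ} (h : p = 2 * N ∨ c = 0) :
    c • (affineK : Affine g) ∈ affineDeg N 𝒢 p := by
  rcases h with rfl | rfl
  · exact ⟨fun j => by simp [affineK], by simp⟩
  · simp

theorem affineDeg_induction {P : Affine g → Prop} {p : ℤ}
    (central : ∀ c : ℂ, p = 2 * N ∨ c = 0 → P (c • affineK))
    (monomial : ∀ (n : ℤ), ∀ a ∈ 𝒢 (p + 2 * N * n), P (affineOf n a))
    (add : ∀ x y, P x → P y → P (x + y)) {x : Affine g} (hx : x ∈ affineDeg N 𝒢 p) : P x := by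
  rw [Affine.eq_sum_affineOf_add_smul_affineK x]
  refine add _ _ (Finset.sum_induction _ P add ?_ fun n _ => monomial n _ (hx.1 n))
    (central _ ?_)
  · simpa using central 0 (Or.inr rfl)
  · refine or_iff_not_imp_left.2 fun hp => ?_
    have hc := hx.2
    rwa [if_neg hp] at hc

theorem affineDeg_induction₂ {P : Affine g → Affine g → Prop} {p q : ℤ}
    (central_left : ∀ (c : ℂ) y, P (c • affineK) y)
    (central_right : ∀ x (c : ℂ), P x (c • affineK))
    (monomials : ∀ m n : ℤ, ∀ a ∈ 𝒢 (p + 2 * N * m), ∀ b ∈ 𝒢 (q + 2 * N * n),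
      P (affineOf m a) (affineOf n b))
    (add_left : ∀ x x' y, P x y → P x' y → P (x + x') y)
    (add_right : ∀ x y y', P x y → P x y' → P x (y + y'))
    {x y : Affine g} (hx : x ∈ affineDeg N 𝒢 p) (hy : y ∈ affineDeg N 𝒢 q) : P x y := by
  refine affineDeg_induction (P := fun x => P x y) (fun c _ => central_left c y)
    (fun m a ha => ?_) (fun x x' => add_left x x' y) hx
  exact affineDeg_induction (P := P (affineOf m a)) (fun c _ => central_right _ c)
    (fun n b hb => monomials m n a ha b hb) (add_right _) hy

theorem affineDeg_isCochainComplex (hg : IsCochainComplex 𝒢 d) :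
    IsCochainComplex (affineDeg N 𝒢) (affineD d) where
  isInternal := isInternal_prod
    (isInternal_finsupp fun n : ℤ =>
      isInternal_comp_equiv hg.isInternal (Equiv.addRight (2 * N * n)))
    (isInternal_concentrated (2 * N))
  d_mem p v hv := by
    refine ⟨fun n => ?_, by simp [affineD]⟩
    have h := hg.d_mem _ _ (hv.1 n)
    rw [add_right_comm] at h
    simpa [affineD, loopD] using h
  d_d v := by
    ext
    · simp [affineD, loopD, hg.d_d]
    · simp [affineD]

theorem affineBracket_mem (hg : IsDGLieAlgebra (-2 * N) 𝒢 d br)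
    (hform : IsInvariantForm (-2 * N) 𝒢 d br form) {p q : ℤ} {x y : Affine g}
    (hx : x ∈ affineDeg N 𝒢 p) (hy : y ∈ affineDeg N 𝒢 q) :
    affineBracket br form x y ∈ affineDeg N 𝒢 (p + q + -2 * N) := by
  refine affineDeg_induction₂ (P := fun x y => affineBracket br form x y ∈ affineDeg N 𝒢 _)
    (fun c y => by simp [affineBracket_affineK_left])
    (fun x c => by simp [affineBracket_affineK_right]) (fun m n a ha b hb => ?_)
    (fun x x' y h h' => ?_) (fun x y y' h h' => ?_) hx hy
  · rw [affineBracket_affineOf]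
    refine add_mem (affineOf_mem ?_) (smul_affineK_mem ?_)
    · convert hg.br_mem _ _ a b ha hb using 2
      ring
    · by_cases hmn : m + n = 0
      · by_cases hdeg : p + 2 * N * m + (q + 2 * N * n) = 4 * N
        · left
          linear_combination hdeg - 2 * N * hmn
        · right
          rw [hform.form_eq_zero ha hb hdeg, mul_zero]
      · simp [hmn]
  · rw [map_add, LinearMap.add_apply]
    exact add_mem h h'
  · rw [map_add]
    exact add_mem h h'

theorem affineD_affineBracket (hg : IsDGLieAlgebra (-2 * N) 𝒢 d br)
    (hform : IsInvariantForm (-2 * N) 𝒢 d br form) {p : ℤ} {x : Affine g}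
    (hx : x ∈ affineDeg N 𝒢 p) (y : Affine g) :
    affineD d (affineBracket br form x y) = affineBracket br form (affineD d x) y +
      (-1 : ℂ) ^ p • affineBracket br form x (affineD d y) := by
  refine affineDeg_induction
    (P := fun x => affineD d (affineBracket br form x y) = affineBracket br form (affineD d x) y +
      (-1 : ℂ) ^ p • affineBracket br form x (affineD d y))
    (fun c _ => ?_) (fun m a ha => ?_) (fun x x' h h' => ?_) hx
  · simp [affineBracket_affineK_left, affineD_affineK]
  · have hsign : (-1 : ℂ) ^ (p + 2 * N * m) = (-1 : ℂ) ^ p := by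
      rw [mul_assoc, neg_one_zpow_add_two_mul]
    induction y using Affine.induction_affineOf with
    | central c => simp [affineBracket_affineK_right, affineD_affineK]
    | add y y' h h' =>
      simp only [map_add, h, h', smul_add]
      abel
    | monomial n b =>
      have hform_d : form (d a) b = -((-1 : ℂ) ^ p * form a (d b)) := by
        rw [← hsign]
        exact eq_neg_of_add_eq_zero_left (hform.d_form_even ha b)
      simp only [affineBracket_affineOf, map_add, map_smul, affineD_affineOf, affineD_affineK,
        hg.d_br_even ha, hsign, affineOf_add, affineOf_smul, smul_zero, add_zero, smul_add,
        hform_d]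
      module
  · simp only [map_add, LinearMap.add_apply, h, h', smul_add]
    abel

theorem affineBracket_antisymm (hg : IsDGLieAlgebra (-2 * N) 𝒢 d br)
    (hform : IsInvariantForm (-2 * N) 𝒢 d br form) {p q : ℤ} {x y : Affine g}
    (hx : x ∈ affineDeg N 𝒢 p) (hy : y ∈ affineDeg N 𝒢 q) :
    affineBracket br form x y = -((-1 : ℂ) ^ (p * q) • affineBracket br form y x) := by
  refine affineDeg_induction₂
    (P := fun x y => affineBracket br form x y = -((-1 : ℂ) ^ (p * q) • affineBracket br form y x))
    (fun c y => by simp [affineBracket_affineK_left, affineBracket_affineK_right])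
    (fun x c => by simp [affineBracket_affineK_left, affineBracket_affineK_right])
    (fun m n a ha b hb => ?_)
    (fun x x' y h h' => by simp only [map_add, LinearMap.add_apply, h, h', smul_add, neg_add])
    (fun x y y' h h' => by simp only [map_add, LinearMap.add_apply, h, h', smul_add, neg_add])
    hx hy
  rw [affineBracket_affineOf, affineBracket_affineOf, hg.antisymm_even ha hb,
    hform.symm_even ha hb, mul_assoc 2 N m, mul_assoc 2 N n,
    neg_one_zpow_add_two_mul_mul_add_two_mul, affineOf_neg, affineOf_smul, add_comm n m]
  by_cases hmn : m + n = 0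
  · obtain rfl : n = -m := by omega
    simp only [hmn, if_true]
    push_cast
    module
  · simp [hmn]

theorem affineBracket_jacobi (hg : IsDGLieAlgebra (-2 * N) 𝒢 d br)
    (hform : IsInvariantForm (-2 * N) 𝒢 d br form) {p q : ℤ} {x y : Affine g}
    (hx : x ∈ affineDeg N 𝒢 p) (hy : y ∈ affineDeg N 𝒢 q) (z : Affine g) :
    affineBracket br form x (affineBracket br form y z) =
      affineBracket br form (affineBracket br form x y) z +
        (-1 : ℂ) ^ (p * q) • affineBracket br form y (affineBracket br form x z) := by
  refine affineDeg_induction₂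
    (P := fun x y => affineBracket br form x (affineBracket br form y z) =
      affineBracket br form (affineBracket br form x y) z +
        (-1 : ℂ) ^ (p * q) • affineBracket br form y (affineBracket br form x z))
    (fun c y => by simp [affineBracket_affineK_left])
    (fun x c => by simp [affineBracket_affineK_left, affineBracket_affineK_right])
    (fun m n a ha b hb => ?_) (fun x x' y h h' => ?_) (fun x y y' h h' => ?_) hx hy
  · induction z using Affine.induction_affineOf with
    | central c => simp [affineBracket_affineK_right]
    | add z z' h h' =>
      simp only [map_add, h, h', smul_add]
      abel
    | monomial k c =>
      have hsign : (-1 : ℂ) ^ ((p + 2 * N * m) * (q + 2 * N * n)) = (-1 : ℂ) ^ (p * q) := by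
        rw [mul_assoc 2 N m, mul_assoc 2 N n, neg_one_zpow_add_two_mul_mul_add_two_mul]
      have hswap : (-1 : ℂ) ^ (p * q) * form b (br a c) = -form (br a b) c := by
        rw [← hsign, hform.form_br_swap hg ha hb]
      simp only [affineBracket_affineOf, map_add, LinearMap.add_apply, map_smul,
        LinearMap.smul_apply, affineBracket_affineK_left, affineBracket_affineK_right,
        smul_zero, add_zero, hg.jacobi_even ha hb, hsign, affineOf_add, affineOf_smul, smul_add]
      rw [← hform.invariant, smul_smul, mul_left_comm, hswap, add_assoc m n k,
        add_left_comm n m k]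
      by_cases hmnk : m + (n + k) = 0
      · simp only [hmnk, if_true]
        push_cast
        module
      · simp [hmnk]
  all_goals
    simp only [map_add, LinearMap.add_apply, h, h', smul_add]
    abel

theorem isDGLieAlgebra_affine (hg : IsDGLieAlgebra (-2 * N) 𝒢 d br)
    (hform : IsInvariantForm (-2 * N) 𝒢 d br form) :
    IsDGLieAlgebra (-2 * N) (affineDeg N 𝒢) (affineD d) (affineBracket br form) where
  toIsCochainComplex := affineDeg_isCochainComplex hg.toIsCochainComplex
  br_mem _ _ _ _ hx hy := affineBracket_mem hg hform hx hy
  d_br p x y hx := by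
    rw [show p + -2 * N = p + 2 * -N by ring, neg_one_zpow_add_two_mul]
    exact affineD_affineBracket hg hform hx y
  antisymm p q x y hx hy := by
    rw [show -2 * N = 2 * -N by ring, neg_one_zpow_add_two_mul_mul_add_two_mul]
    exact affineBracket_antisymm hg hform hx hy
  jacobi p q x y z hx hy := by
    rw [show -2 * N = 2 * -N by ring, neg_one_zpow_add_two_mul_mul_add_two_mul]
    exact affineBracket_jacobi hg hform hx hy z

end Affine

/-! ### The isomorphism `𝓛(ℂ[D] ⊗ g ⊕ ℂK) ≃ ĝ` -/

theorem IsDGLieIso.isDGLieAlgebra {V W : Type*} [AddCommGroup V] [Module ℂ V] [AddCommGroup W]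
    [Module ℂ W] {𝒱 : ℤ → Submodule ℂ V} {dV : V →ₗ[ℂ] V} {brV : V →ₗ[ℂ] V →ₗ[ℂ] V}
    {𝒲 : ℤ → Submodule ℂ W} {dW : W →ₗ[ℂ] W} {brW : W →ₗ[ℂ] W →ₗ[ℂ] W} {φ : V ≃ₗ[ℂ] W} {q : ℤ}
    (hφ : IsDGLieIso 𝒱 dV brV 𝒲 dW brW φ) (hW : IsDGLieAlgebra q 𝒲 dW brW) :
    IsDGLieAlgebra q 𝒱 dV brV where
  isInternal := by
    convert isInternal_comap_equiv hW.isInternal φ using 1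
    ext p v
    exact (hφ.mem_iff p v).symm
  d_mem p v hv := by
    rw [← hφ.mem_iff] at hv ⊢
    rw [hφ.map_d]
    exact hW.d_mem p _ hv
  d_d v := φ.injective (by rw [hφ.map_d, hφ.map_d, hW.d_d, map_zero])
  br_mem m n a b ha hb := by
    rw [← hφ.mem_iff] at ha hb ⊢
    rw [hφ.map_br]
    exact hW.br_mem m n _ _ ha hb
  d_br m a b ha := φ.injective (by
    rw [← hφ.mem_iff] at ha
    simp only [hφ.map_d, hφ.map_br, map_add, map_smul]
    exact hW.d_br m _ _ ha)
  antisymm m n a b ha hb := φ.injective (by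
    rw [← hφ.mem_iff] at ha hb
    simp only [hφ.map_br, map_neg, map_smul]
    exact hW.antisymm m n _ _ ha hb)
  jacobi m n a b c ha hb := φ.injective (by
    rw [← hφ.mem_iff] at ha hb
    simp only [hφ.map_br, map_add, map_smul]
    exact hW.jacobi m n _ _ _ ha hb)

section ModeLie

variable {U : Type*} [AddCommGroup U] [Module ℂ U] {D : U →ₗ[ℂ] U} {N : ℤ}
  {𝒰 : ℤ → Submodule ℂ U}

theorem modeOf_D (n : ℤ) (u : U) : modeOf D n (D u) = -((n : ℂ) • modeOf D (n - 1) u) := by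
  rw [eq_neg_iff_add_eq_zero]
  have h : (LinearMap.range (Dhat D)).mkQ (Dhat D (Finsupp.single n u)) = 0 := by
    rw [Submodule.mkQ_apply, Submodule.Quotient.mk_eq_zero]
    exact ⟨_, rfl⟩
  rwa [Dhat_single, map_add, map_smul] at h

theorem modeOf_eq_zero_of_D_eq_zero {n : ℤ} {u : U} (hu : D u = 0) (hn : n ≠ -1) :
    modeOf D n u = 0 := by
  have h := modeOf_D (D := D) (n + 1) u
  rw [hu, map_zero, zero_eq_neg, add_sub_cancel_right, smul_eq_zero] at h
  refine h.resolve_left ?_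
  exact_mod_cast fun h' => hn (by omega)

theorem ModeLie.induction_modeOf {P : ModeLie D → Prop} (monomial : ∀ n u, P (modeOf D n u))
    (add : ∀ x y, P x → P y → P (x + y)) (x : ModeLie D) : P x := by
  obtain ⟨f, rfl⟩ := Submodule.mkQ_surjective _ x
  induction f using Finsupp.induction_linear with
  | zero => simpa using monomial 0 0
  | add f f' hf hf' => simpa using add _ _ hf hf'
  | single n u => exact monomial n u

theorem modeOf_mem {p n : ℤ} {u : U} (hu : u ∈ 𝒰 (p + 2 * N * n)) :
    modeOf D n u ∈ modeLieDeg N 𝒰 D p := by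
  refine ⟨Finsupp.single n u, fun j => ?_, rfl⟩
  rw [Finsupp.single_apply]
  split_ifs with h
  · exact h ▸ hu
  · exact zero_mem _

theorem modeLieDeg_induction {P : ModeLie D → Prop} {p : ℤ}
    (monomial : ∀ (n : ℤ), ∀ u ∈ 𝒰 (p + 2 * N * n), P (modeOf D n u))
    (add : ∀ x y, P x → P y → P (x + y)) {x : ModeLie D} (hx : x ∈ modeLieDeg N 𝒰 D p) : P x := by
  obtain ⟨f, hf, rfl⟩ := hx
  rw [← Finsupp.sum_single f, Finsupp.sum, map_sum]
  refine Finset.sum_induction _ P add ?_ fun n _ => monomial n _ (hf n)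
  simpa using monomial 0 0 (zero_mem _)

theorem IsDGVertexLieAlgebra.modeLieD_modeOf {d : U →ₗ[ℂ] U} {mode : ℕ → U →ₗ[ℂ] U →ₗ[ℂ] U}
    (hU : IsDGVertexLieAlgebra N 𝒰 d mode D) (n : ℤ) (u : U) :
    hU.modeLieD (modeOf D n u) = modeOf D n (d u) := by
  simp [IsDGVertexLieAlgebra.modeLieD, modeOf, loopD]

end ModeLie

section Equiv

variable {g : Type*} [AddCommGroup g] [Module ℂ g] {N : ℤ} {𝒢 : ℤ → Submodule ℂ g}
  {d : g →ₗ[ℂ] g} {br : g →ₗ[ℂ] g →ₗ[ℂ] g} {form : g →ₗ[ℂ] g →ₗ[ℂ] ℂ}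

/-- The image of `u ⊗ t ^ n` in `ĝ`. Since `(D u)_n = -n u_(n-1)` in `𝓛(U)`, the element `D ^ k a`
is sent to `(-n)(-n + 1) ⋯ (-n + k - 1) a ⊗ t ^ (n - k)`, and `K` to `δ_{n,-1} K`. -/
def currentToAffine (n : ℤ) : Current g →ₗ[ℂ] Affine g :=
  LinearMap.coprod
    (Finsupp.lsum ℂ fun k : ℕ => (ascPochhammer ℂ k).eval (-(n : ℂ)) •
      (LinearMap.inl ℂ (ℤ →₀ g) ℂ).comp (Finsupp.lsingle (n - k)))
    ((if n = -1 then (1 : ℂ) else 0) • LinearMap.inr ℂ (ℤ →₀ g) ℂ)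

theorem currentToAffine_currentOf (n : ℤ) (k : ℕ) (a : g) :
    currentToAffine n (currentOf k a) =
      (ascPochhammer ℂ k).eval (-(n : ℂ)) • affineOf (n - k) a := by
  simp [currentToAffine, currentOf, affineOf]

theorem currentToAffine_generator (n : ℤ) (a : g) :
    currentToAffine n (currentOf 0 a) = affineOf n a := by
  simp [currentToAffine_currentOf]

theorem currentToAffine_currentK (n : ℤ) :
    currentToAffine n (currentK : Current g) = (if n = -1 then (1 : ℂ) else 0) • affineK := by
  by_cases h : n = -1 <;> simp [currentToAffine, currentK, affineK, h]

theorem currentToAffine_currentD (n : ℤ) (u : Current g) :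
    currentToAffine n (currentD u) = -((n : ℂ) • currentToAffine (n - 1) u) := by
  induction u using Current.induction_currentOf with
  | central c =>
    rw [map_smul, map_smul, map_smul, currentD_currentK, currentToAffine_currentK]
    by_cases h : n = 0
    · simp [h]
    · simp [show ¬ n - 1 = -1 by omega]
  | add u v hu hv => simp only [map_add, hu, hv, smul_add, neg_add]
  | monomial k a =>
    have hpoch : (ascPochhammer ℂ (k + 1)).eval (-(n : ℂ)) =
        -(n * (ascPochhammer ℂ k).eval (-((n - 1 : ℤ) : ℂ))) := by
      simp [ascPochhammer_succ_left, neg_add_eq_sub]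
    rw [currentD_currentOf, currentToAffine_currentOf, currentToAffine_currentOf, hpoch,
      smul_smul, ← neg_smul]
    congr 2
    push_cast
    ring

theorem currentToAffine_currentDiff (n : ℤ) (u : Current g) :
    currentToAffine n (currentDiff d u) = affineD d (currentToAffine n u) := by
  induction u using Current.induction_currentOf with
  | central c =>
    simp only [map_smul, currentDiff_currentK, currentToAffine_currentK, affineD_affineK,
      smul_zero, map_zero]
  | add u v hu hv => simp only [map_add, hu, hv]
  | monomial k a =>
    rw [currentDiff_currentOf, currentToAffine_currentOf, currentToAffine_currentOf, map_smul,
      affineD_affineOf]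

theorem currentToAffine_mem {p n : ℤ} {u : Current g} (hu : u ∈ currentDeg N 𝒢 (p + 2 * N * n)) :
    currentToAffine n u ∈ affineDeg N 𝒢 p := by
  rw [Current.eq_sum_currentOf_add_smul_currentK u, map_add, map_sum, map_smul,
    currentToAffine_currentK, smul_smul]
  refine add_mem (sum_mem fun k _ => ?_) (smul_affineK_mem ?_)
  · rw [currentToAffine_currentOf]
    refine Submodule.smul_mem _ _ (affineOf_mem ?_)
    convert hu.1 k using 2
    ring
  · by_cases hn : n = -1
    · subst hn
      by_cases hp : p + 2 * N * -1 = 0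
      · left
        linear_combination hp
      · right
        have hc := hu.2
        rw [if_neg hp] at hc
        rw [(Submodule.mem_bot ℂ).1 hc, zero_mul]
    · simp [hn]

/-- The linear map `𝓛(U) → ĝ` given on classes by `currentToAffine`. -/
def modeLieToAffine : ModeLie (currentD : Current g →ₗ[ℂ] Current g) →ₗ[ℂ] Affine g :=
  Submodule.liftQ _ (Finsupp.lsum ℂ currentToAffine) <| by
    rintro _ ⟨f, rfl⟩
    rw [LinearMap.mem_ker]
    induction f using Finsupp.induction_linear with
    | zero => simp
    | add f f' hf hf' => rw [map_add, map_add, hf, hf', add_zero]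
    | single n u =>
      rw [Dhat_single, map_add, map_smul]
      simp [currentToAffine_currentD]

theorem modeLieToAffine_modeOf (n : ℤ) (u : Current g) :
    modeLieToAffine (modeOf currentD n u) = currentToAffine n u := by
  simp [modeLieToAffine, modeOf]

/-- The linear map `ĝ → 𝓛(U)` with `a ⊗ t ^ n ↦ a_n` and `K ↦ K_(-1)`, inverse to
`modeLieToAffine`. -/
def affineToModeLie : Affine g →ₗ[ℂ] ModeLie (currentD : Current g →ₗ[ℂ] Current g) :=
  LinearMap.coprod (Finsupp.lsum ℂ fun n : ℤ => (modeOf (currentD (g := g)) n).comp (currentOf 0))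
    (LinearMap.toSpanSingleton ℂ _ (modeOf currentD (-1) currentK))

theorem affineToModeLie_affineOf (n : ℤ) (a : g) :
    affineToModeLie (affineOf n a) = modeOf currentD n (currentOf 0 a) := by
  simp [affineToModeLie, affineOf]

theorem affineToModeLie_affineK :
    affineToModeLie (affineK : Affine g) = modeOf currentD (-1) (currentK : Current g) := by
  simp [affineToModeLie, affineK]

theorem modeOf_currentK {n : ℤ} (hn : n ≠ -1) :
    modeOf currentD n (currentK : Current g) = 0 :=
  modeOf_eq_zero_of_D_eq_zero currentD_currentK hn

theorem affineToModeLie_currentToAffine (n : ℤ) (u : Current g) :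
    affineToModeLie (currentToAffine n u) = modeOf currentD n u := by
  induction u using Current.induction_currentD generalizing n with
  | central c =>
    rw [map_smul, map_smul, map_smul, currentToAffine_currentK, map_smul, affineToModeLie_affineK]
    by_cases h : n = -1
    · simp [h]
    · simp [h, modeOf_currentK h]
  | add u v hu hv => simp only [map_add, hu, hv]
  | translate u hu => rw [currentToAffine_currentD, map_neg, map_smul, hu, modeOf_D]
  | generator a => rw [currentToAffine_generator, affineToModeLie_affineOf]

theorem affineToModeLie_modeLieToAffine
    (x : ModeLie (currentD : Current g →ₗ[ℂ] Current g)) :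
    affineToModeLie (modeLieToAffine x) = x := by
  induction x using ModeLie.induction_modeOf with
  | monomial n u => rw [modeLieToAffine_modeOf, affineToModeLie_currentToAffine]
  | add x y hx hy => simp only [map_add, hx, hy]

theorem modeLieToAffine_affineToModeLie (x : Affine g) :
    modeLieToAffine (affineToModeLie x) = x := by
  induction x using Affine.induction_affineOf with
  | central c =>
    rw [map_smul, map_smul, affineToModeLie_affineK, modeLieToAffine_modeOf,
      currentToAffine_currentK, if_pos rfl, one_smul]
  | monomial n a =>
    rw [affineToModeLie_affineOf, modeLieToAffine_modeOf, currentToAffine_generator]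
  | add x y hx hy => simp only [map_add, hx, hy]

/-- The linear isomorphism `𝓛(U) ≃ ĝ` with `a_n ↦ a ⊗ t ^ n` and `K_(-1) ↦ K`. -/
def modeLieEquivAffine : ModeLie (currentD : Current g →ₗ[ℂ] Current g) ≃ₗ[ℂ] Affine g where
  __ := modeLieToAffine
  invFun := affineToModeLie
  left_inv := affineToModeLie_modeLieToAffine
  right_inv := modeLieToAffine_affineToModeLie

theorem modeLieEquivAffine_generator (n : ℤ) (a : g) :
    modeLieEquivAffine (modeOf currentD n (currentOf 0 a)) = affineOf n a :=
  (modeLieToAffine_modeOf n _).trans (currentToAffine_generator n a)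

theorem modeLieEquivAffine_currentK :
    modeLieEquivAffine (modeOf currentD (-1) (currentK : Current g)) = affineK :=
  (modeLieToAffine_modeOf _ _).trans (by rw [currentToAffine_currentK, if_pos rfl, one_smul])

theorem modeLieToAffine_mem {p : ℤ} {x : ModeLie (currentD : Current g →ₗ[ℂ] Current g)}
    (hx : x ∈ modeLieDeg N (currentDeg N 𝒢) currentD p) :
    modeLieToAffine x ∈ affineDeg N 𝒢 p := by
  refine modeLieDeg_induction (P := fun x => modeLieToAffine x ∈ _) (fun n u hu => ?_)
    (fun x y h h' => ?_) hx
  · rw [modeLieToAffine_modeOf]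
    exact currentToAffine_mem hu
  · rw [map_add]
    exact add_mem h h'

theorem affineToModeLie_mem {p : ℤ} {x : Affine g} (hx : x ∈ affineDeg N 𝒢 p) :
    affineToModeLie x ∈ modeLieDeg N (currentDeg N 𝒢) currentD p := by
  refine affineDeg_induction (P := fun x => affineToModeLie x ∈ _) (fun c hc => ?_)
    (fun n a ha => ?_) (fun x y h h' => ?_) hx
  · rw [map_smul, affineToModeLie_affineK, ← (modeOf _ _).map_smul]
    refine modeOf_mem (smul_currentK_mem (hc.imp_left fun hp => ?_))
    rw [hp]
    ring
  · rw [affineToModeLie_affineOf]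
    exact modeOf_mem (currentOf_mem (by simpa using ha))
  · rw [map_add]
    exact add_mem h h'

theorem modeLieToAffine_modeLieD
    (hU : IsDGVertexLieAlgebra N (currentDeg N 𝒢) (currentDiff d) (currentMode br form) currentD)
    (x : ModeLie (currentD : Current g →ₗ[ℂ] Current g)) :
    modeLieToAffine (hU.modeLieD x) = affineD d (modeLieToAffine x) := by
  induction x using ModeLie.induction_modeOf with
  | monomial n u =>
    rw [hU.modeLieD_modeOf, modeLieToAffine_modeOf, modeLieToAffine_modeOf,
      currentToAffine_currentDiff]
  | add x y hx hy => simp only [map_add, hx, hy]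

theorem modeLieBracket_currentK_left
    (hU : IsDGVertexLieAlgebra N (currentDeg N 𝒢) (currentDiff d) (currentMode br form) currentD)
    (n : ℤ) (y : ModeLie (currentD : Current g →ₗ[ℂ] Current g)) :
    hU.modeLieBracket (modeOf currentD n currentK) y = 0 := by
  induction y using ModeLie.induction_modeOf with
  | monomial p v => simp [hU.modeLieBracket_modeOf, currentMode_K_left]
  | add x y hx hy => rw [map_add, hx, hy, add_zero]

theorem modeLieBracket_currentK_right
    (hU : IsDGVertexLieAlgebra N (currentDeg N 𝒢) (currentDiff d) (currentMode br form) currentD)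
    (n : ℤ) (x : ModeLie (currentD : Current g →ₗ[ℂ] Current g)) :
    hU.modeLieBracket x (modeOf currentD n currentK) = 0 := by
  induction x using ModeLie.induction_modeOf with
  | monomial p v => simp [hU.modeLieBracket_modeOf, currentMode_K_right]
  | add x y hx hy => rw [map_add, LinearMap.add_apply, hx, hy, add_zero]

theorem modeLieBracket_generators
    (hU : IsDGVertexLieAlgebra N (currentDeg N 𝒢) (currentDiff d) (currentMode br form) currentD)
    (n p : ℤ) (a b : g) :
    hU.modeLieBracket (modeOf currentD n (currentOf 0 a)) (modeOf currentD p (currentOf 0 b)) =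
      modeOf currentD (n + p) (currentOf 0 (br a b)) +
        ((n : ℂ) * form a b) • modeOf currentD (n + p - 1) (currentK : Current g) := by
  rw [hU.modeLieBracket_modeOf, finsum_eq_sum_of_support_subset (s := Finset.range 2)]
  · rw [Finset.sum_range_succ, Finset.sum_range_one, currentMode_generators,
      currentMode_generators, generatorMode_zero, generatorMode_one, Ring.choose_zero_right,
      Ring.choose_one_right, one_smul, map_smul, ← Int.cast_smul_eq_zsmul ℂ, smul_smul]
    simp
  · refine Function.support_subset_iff'.2 fun i hi => ?_
    obtain ⟨i, rfl⟩ := Nat.exists_eq_add_of_le' (show 2 ≤ i by simpa [Nat.succ_le_iff] using hi)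
    rw [currentMode_generators, generatorMode_add_two, map_zero, smul_zero]

theorem modeLieBracket_affineToModeLie
    (hU : IsDGVertexLieAlgebra N (currentDeg N 𝒢) (currentDiff d) (currentMode br form) currentD)
    (x y : Affine g) :
    hU.modeLieBracket (affineToModeLie x) (affineToModeLie y) =
      affineToModeLie (affineBracket br form x y) := by
  induction x using Affine.induction_affineOf with
  | central c =>
    simp only [map_smul, LinearMap.smul_apply, affineToModeLie_affineK,
      modeLieBracket_currentK_left, affineBracket_affineK_left, smul_zero, map_zero]
  | add x x' h h' => simp only [map_add, LinearMap.add_apply, h, h']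
  | monomial m a =>
    induction y using Affine.induction_affineOf with
    | central c =>
      simp only [map_smul, affineToModeLie_affineK, modeLieBracket_currentK_right,
        affineBracket_affineK_right, smul_zero, map_zero]
    | add y y' h h' => simp only [map_add, h, h']
    | monomial n b =>
      rw [affineToModeLie_affineOf, affineToModeLie_affineOf, modeLieBracket_generators,
        affineBracket_affineOf, map_add, map_smul, affineToModeLie_affineOf,
        affineToModeLie_affineK]
      by_cases h : m + n = 0
      · rw [if_pos h, h, zero_sub]
      · rw [if_neg h, modeOf_currentK (show m + n - 1 ≠ -1 by omega), zero_mul, zero_smul,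
          smul_zero]

theorem isDGLieIso_modeLieEquivAffine
    (hU : IsDGVertexLieAlgebra N (currentDeg N 𝒢) (currentDiff d) (currentMode br form) currentD) :
    IsDGLieIso (modeLieDeg N (currentDeg N 𝒢) currentD) hU.modeLieD hU.modeLieBracket
      (affineDeg N 𝒢) (affineD d) (affineBracket br form) modeLieEquivAffine where
  mem_iff p x := by
    refine ⟨fun hx => ?_, modeLieToAffine_mem⟩
    rw [← affineToModeLie_modeLieToAffine x]
    exact affineToModeLie_mem hx
  map_d := modeLieToAffine_modeLieD hU
  map_br x y := by
    have h := modeLieBracket_affineToModeLie hU (modeLieToAffine x) (modeLieToAffine y)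
    rw [affineToModeLie_modeLieToAffine, affineToModeLie_modeLieToAffine] at h
    exact (congrArg modeLieToAffine h).trans (modeLieToAffine_affineToModeLie _)

end Equiv

end DGVertex

end

theorem mainTheorem9 {g : Type*} [AddCommGroup g] [Module ℂ g] (N : ℤ)
    (𝒢 : ℤ → Submodule ℂ g) (d : g →ₗ[ℂ] g) (br : g →ₗ[ℂ] g →ₗ[ℂ] g)
    (form : g →ₗ[ℂ] g →ₗ[ℂ] ℂ)
    (hg : IsDGLieAlgebra (-2 * N) 𝒢 d br)
    (hform : IsInvariantForm (-2 * N) 𝒢 d br form) :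
    ∃ hU : IsDGVertexLieAlgebra N (currentDeg N 𝒢) (currentDiff d) (currentMode br form) currentD,
      IsDGLieAlgebra (-2 * N) (modeLieDeg N (currentDeg N 𝒢) currentD)
        hU.modeLieD hU.modeLieBracket ∧
      IsDGLieAlgebra (-2 * N) (affineDeg N 𝒢) (affineD d) (affineBracket br form) ∧
      ∃ φ : ModeLie (currentD : Current g →ₗ[ℂ] Current g) ≃ₗ[ℂ] Affine g,
        IsDGLieIso (modeLieDeg N (currentDeg N 𝒢) currentD) hU.modeLieD hU.modeLieBracket
          (affineDeg N 𝒢) (affineD d) (affineBracket br form) φ ∧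
        (∀ (a : g) (n : ℤ), φ (modeOf currentD n (currentOf 0 a)) = affineOf n a) ∧
        φ (modeOf currentD (-1) currentK) = affineK := by
  have hU := isDGVertexLieAlgebra_current hg hform
  have hA := isDGLieAlgebra_affine hg hform
  have hφ := isDGLieIso_modeLieEquivAffine hU
  exact ⟨hU, hφ.isDGLieAlgebra hA, hA, modeLieEquivAffine, hφ,
    fun a n => modeLieEquivAffine_generator n a, modeLieEquivAffine_currentK⟩
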